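/- Let $p\in\mathbb N_0$, $\vec n=(n_1,\dots,n_p)\in\mathbb N_0^p$, $|\vec n|=n_1+\cdots+n_p$, and let $\alpha_1,\dots,\alpha_p,\beta>-1$ be real with $\alpha_i-\alpha_j\notin\mathbb Z$ for $i\neq j$. Let $P_{\vec n}$ be the type II Jacobi–Piñeiro polynomial, i.e. the monic polynomial of degree $|\vec n|$ with $$\int_0^1 x^j P_{\vec n}(x)\,x^{\alpha_i}(1-x)^\beta\,dx=0,\qquad 0\le j\le n_i-1,\quad 1\le i\le p .$$ Write $(z)_k=z(z+1)\cdots(z+k-1)$, $(z)_0=1$. Let $\mathcal C$ be an anticlockwise contour enclosing $(-\infty,0]$ once, i.e. a curve $\gamma:\mathbb R\to\mathbb C\setminus(-\infty,0]$ that is continuous, differentiable off a countable set with locally integrable derivative (for instance locally piecewise $C^1$), with $\operatorname{Re}\gamma(t)\to-\infty$ as $t\to\pm\infty$, with $\operatorname{Im}\gamma(t)<0$ for all sufficiently negative $t$ and $\operatorname{Im}\gamma(t)>0$ for all sufficiently large $t$. Then, for every $x\in(0,1)$, $$P_{\vec n}(x)(1-x)^\beta=\frac{(-1)^{|\vec n|}\,\Gamma(|\vec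 n|+\beta+1)}{\prod_{i=1}^p(\alpha_i+\beta+|\vec n|+1)_{n_i}}\int_{\mathcal C}\frac{\Gamma(s)}{\Gamma(s+|\vec n|+\beta+1)}\prod_{i=1}^p(\alpha_i+1-s)_{n_i}\,x^{-s}\,\frac{ds}{2\pi i},$$ where $\int_{\mathcal C}$ is the improper integral $\lim_{T_1\to-\infty,\,T_2\to+\infty}\int_{T_1}^{T_2}(\cdot)(\gamma(t))\,\gamma'(t)\,dt$ ($T_1$ and $T_2$ tending to their limits independently). More precisely: the equality holds whenever this improper integral converges, and it does converge whenever $\mathcal C$ stays at a positive distance from $(-\infty,0]$. -/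

import Mathlib

noncomputable section

open Filter Topology

/-- The rising factorial (Pochhammer symbol) `(z)_k = z (z + 1) ⋯ (z + k - 1)`. -/
def rising (z : ℂ) (k : ℕ) : ℂ := (ascPochhammer ℂ k).eval z

/-- The Jacobi weight `x ^ a * (1 - x) ^ b` on `(0, 1)`. -/
def jacobiWeight (a b x : ℝ) : ℝ := x ^ a * (1 - x) ^ b

/-- `P` is the type II Jacobi–Piñeiro multiple orthogonal polynomial for the multi-index `n` and
the weights `jacobiWeight (α i) β`: it is monic of degree `|n| = ∑ i, n i`, and orthogonal to
`x ^ j` with respect to the `i`-th weight on `[0, 1]` for every `j < n i`. -/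
structure IsJacobiPineiroII {p : ℕ} (n : Fin p → ℕ) (α : Fin p → ℝ) (β : ℝ)
    (P : Polynomial ℝ) : Prop where
  monic : P.Monic
  natDegree_eq : P.natDegree = ∑ i, n i
  orthogonal : ∀ i : Fin p, ∀ j : ℕ, j < n i →
    ∫ x in (0 : ℝ)..1, x ^ j * P.eval x * jacobiWeight (α i) β x = 0

/-- The half-line `(-∞, 0]` as a subset of the complex plane. -/
def nonposAxis : Set ℂ := (fun r : ℝ => (r : ℂ)) '' Set.Iic 0

/-- `γ : ℝ → ℂ` parametrizes an anticlockwise contour that encloses `(-∞, 0]` once.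

Regularity: `γ` is continuous, differentiable off a countable set, with locally integrable
derivative (every locally piecewise `C¹` curve is of this kind).

Position: `γ` does not meet `(-∞, 0]`, it comes from `-∞` below the half-line and returns to
`-∞` above it.  Equivalently, if a long piece of `γ` is closed by the segment from its end point
to its starting point, the closed curve has winding number `1` about any given point of
`(-∞, 0]`. -/
structure IsLoopContour (γ : ℝ → ℂ) : Prop where
  continuous : Continuous γ
  differentiable : ∃ D : Set ℝ, D.Countable ∧ ∀ t, t ∉ D → DifferentiableAt ℝ γ t
  locallyIntegrable_deriv : MeasureTheory.LocallyIntegrable (deriv γ)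
  notMem_axis : ∀ t, γ t ∉ nonposAxis
  re_atBot : Tendsto (fun t => (γ t).re) atBot atBot
  re_atTop : Tendsto (fun t => (γ t).re) atTop atBot
  im_atBot : ∀ᶠ t in atBot, (γ t).im < 0
  im_atTop : ∀ᶠ t in atTop, 0 < (γ t).im

/-- The contour integral `∫_γ f(s) ds` over the unbounded contour `γ` converges, as an improper
integral at both ends, to `I`. -/
def HasContourIntegral (f : ℂ → ℂ) (γ : ℝ → ℂ) (I : ℂ) : Prop :=
  Tendsto (fun T : ℝ × ℝ => ∫ t in T.1..T.2, f (γ t) * deriv γ t) (atBot ×ˢ atTop) (𝓝 I)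

end

/-! On `[0, 1)` write `P(u) (1 - u)^β = ∑ c_m u^m`. Integrating against `u^(s-1)` turns this into
the Mellin transform `∑ c_m / (s + m)`, whose only singularities are simple poles at the
non-positive integers; the residue of `x^(-s) ∑ c_m / (s + m)` at `-m` is `c_m x^m`. A contour
around all the poles therefore recovers `P(x) (1 - x)^β`, once the transform is known in closed
form.

Closed form: Beta integrals give the transform as `Γ(β + 1) Γ(s) G(s) / Γ(s + |n| + β + 1)` with a
polynomial `G` (`mellinPoly`) of degree at most `|n|`. Orthogonality says that `G` vanishes at the
`|n|` points `α_i + 1 + j`, `j < n_i`, distinct because no `α_i - α_j` is an integer. So `G` is a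
multiple of `∏ (α_i + 1 - s)_{n_i}`; the factor is read off at `s = -(|n| + β)`, where only the
leading term of `P`, known by monicity, survives (`IsJacobiPineiroII.mellinPoly_eval_mul`).

Contour: no contour is deformed. The kernel has a primitive `F` on the slit plane, and exponential
decay to the left gives `F` limits `L` above and `L'` below the slit, approached uniformly away from
the poles. Circles of radius `M + 1/2` identify `L - L'` as `2πi` times the residue sum
(`exists_primitive_poleKernel`), and an integral along any loop contour is a difference of values of
`F`. -/

section

open Filter Topology

/-! ### Series with simple poles at the non-positive integers -/

/-- The Cauchy-type series `∑ m, c m / (s + m)`, with simple poles at the non-positive integers. -/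
noncomputable def poleSeries (c : ℕ → ℂ) (s : ℂ) : ℂ := ∑' m : ℕ, c m / (s + m)

/-- The complex plane without the non-positive integers. -/
def poleCompl : Set ℂ := {s : ℂ | ∀ m : ℕ, s + m ≠ 0}

theorem isOpen_poleCompl : IsOpen poleCompl := by
  have h : IsClosed ((fun z : ℤ => (z : ℂ)) '' (Set.Iic 0)) :=
    Complex.isClosedEmbedding_intCast.isClosedMap _ (isClosed_discrete _)
  convert h.isOpen_compl using 1
  ext s
  simp only [poleCompl, Set.mem_ofPred_eq, Set.mem_compl_iff, Set.mem_image, Set.mem_Iic, not_exists,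
    not_and]
  constructor
  · intro hs k hk he
    obtain ⟨m, rfl⟩ : ∃ m : ℕ, k = -(m : ℤ) := ⟨k.natAbs, by omega⟩
    exact hs m (by rw [← he]; push_cast; ring)
  · intro hs m he
    exact hs (-(m : ℤ)) (by omega) (by push_cast; linear_combination -he)

theorem slitPlane_subset_poleCompl : Complex.slitPlane ⊆ poleCompl := by
  intro s hs m he
  have : s = -(m : ℂ) := by linear_combination he
  rw [this, Complex.mem_slitPlane_iff] at hs
  rcases hs with h | h
  · simp at h
    have := Nat.cast_nonneg (α := ℝ) m
    linarith
  · simp at h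

/-- At distance `δ` from the poles, `m + 1` is at most `‖s + m‖` times a factor linear in `|Re s|`.
Hence summability of `‖c m‖ / (m + 1)` is all the convergence needed below, and the series grows at
most linearly in `|Re s|`. -/
theorem norm_div_add_natCast_le (c : ℕ → ℂ) {δ : ℝ} (hδ : 0 < δ) {s : ℂ}
    (hs : ∀ m : ℕ, δ ≤ ‖s + m‖) (m : ℕ) :
    ‖c m / (s + m)‖ ≤ ‖c m‖ / (m + 1) * (1 + (|s.re| + 1) / δ) := by
  have hpos : 0 < ‖s + m‖ := hδ.trans_le (hs m)
  have h1 : (m : ℝ) + 1 ≤ ‖s + m‖ * (1 + (|s.re| + 1) / δ) := by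
    have h2 : |(s + m).re| ≤ ‖s + m‖ := Complex.abs_re_le_norm _
    have h3 : (m : ℝ) ≤ |(s + m).re| + |s.re| := by
      have := abs_sub ((s + m).re) s.re
      simp only [Complex.add_re, Complex.natCast_re, add_sub_cancel_left, Nat.abs_cast] at this ⊢
      exact this
    have h4 : |s.re| + 1 ≤ ‖s + m‖ * ((|s.re| + 1) / δ) := by
      rw [mul_div_assoc', le_div_iff₀ hδ, mul_comm]
      exact mul_le_mul_of_nonneg_right (hs m) (by positivity)
    linarith
  rw [norm_div, div_mul_eq_mul_div, div_le_div_iff₀ hpos (by positivity)]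
  calc ‖c m‖ * ((m : ℝ) + 1) ≤ ‖c m‖ * (‖s + m‖ * (1 + (|s.re| + 1) / δ)) := by gcongr
    _ = _ := by ring

theorem summable_div_add_natCast {c : ℕ → ℂ} (hc : Summable fun m => ‖c m‖ / ((m : ℝ) + 1)) {δ : ℝ}
    (hδ : 0 < δ) {s : ℂ} (hs : ∀ m : ℕ, δ ≤ ‖s + m‖) : Summable fun m : ℕ => c m / (s + m) :=
  Summable.of_norm_bounded (hc.mul_right _) (norm_div_add_natCast_le c hδ hs)

theorem norm_poleSeries_le {c : ℕ → ℂ} (hc : Summable fun m => ‖c m‖ / ((m : ℝ) + 1)) {δ : ℝ}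
    (hδ : 0 < δ) {s : ℂ} (hs : ∀ m : ℕ, δ ≤ ‖s + m‖) :
    ‖poleSeries c s‖ ≤ (∑' m, ‖c m‖ / ((m : ℝ) + 1)) * (1 + (|s.re| + 1) / δ) :=
  tsum_of_norm_bounded (hc.hasSum.mul_right _) (norm_div_add_natCast_le c hδ hs)

theorem exists_ball_poleCompl {s : ℂ} (hs : s ∈ poleCompl) :
    ∃ δ > 0, ∀ w ∈ Metric.ball s δ, ∀ m : ℕ, δ ≤ ‖w + m‖ := by
  obtain ⟨d, hd, hball⟩ := Metric.isOpen_iff.1 isOpen_poleCompl s hs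
  refine ⟨d / 2, by positivity, fun w hw m => ?_⟩
  by_contra! hlt
  have hmem : -(m : ℂ) ∈ Metric.ball s d := by
    rw [Metric.mem_ball] at hw ⊢
    have h1 : dist (-(m : ℂ)) w = ‖w + m‖ := by
      rw [dist_comm, dist_eq_norm, sub_neg_eq_add]
    have := dist_triangle (-(m : ℂ)) w s
    linarith
  exact hball hmem m (by ring)

theorem differentiableOn_poleSeries {c : ℕ → ℂ} (hc : Summable fun m => ‖c m‖ / ((m : ℝ) + 1)) :
    DifferentiableOn ℂ (poleSeries c) poleCompl := by
  intro s hs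
  obtain ⟨δ, hδ, hball⟩ := exists_ball_poleCompl hs
  have h := Complex.differentiableOn_tsum_of_summable_norm (U := Metric.ball s δ)
    (F := fun (m : ℕ) (w : ℂ) => c m / (w + m)) (hc.mul_right (1 + (|s.re| + δ + 1) / δ))
    (fun m w hw => by
      have : w + m ≠ 0 := norm_pos_iff.1 (hδ.trans_le (hball w hw m))
      exact (by fun_prop (disch := assumption) : DifferentiableAt ℂ (fun w : ℂ => c m / (w + m)) w
        ).differentiableWithinAt)
    Metric.isOpen_ball
    (fun m w hw => by
      refine (norm_div_add_natCast_le c hδ (hball w hw) m).trans ?_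
      have h1 : |w.re| ≤ |s.re| + δ := by
        have h2 := Complex.abs_re_le_norm (w - s)
        rw [Metric.mem_ball, dist_eq_norm] at hw
        rw [Complex.sub_re] at h2
        have := abs_sub_abs_le_abs_sub w.re s.re
        linarith
      gcongr)
  exact (h.differentiableAt (Metric.ball_mem_nhds s hδ)).differentiableWithinAt

/-- The Mellin-Barnes integrand `x ^ (-s) * ∑ m, c m / (s + m)`. -/
noncomputable def poleKernel (c : ℕ → ℂ) (x : ℝ) (s : ℂ) : ℂ := (x : ℂ) ^ (-s) * poleSeries c s

theorem differentiable_ofReal_cpow_neg {x : ℝ} (hx : 0 < x) :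
    Differentiable ℂ fun s : ℂ => (x : ℂ) ^ (-s) := fun s =>
  (differentiableAt_id.neg).const_cpow (Or.inl (by exact_mod_cast hx.ne'))

theorem differentiableOn_poleKernel {c : ℕ → ℂ} (hc : Summable fun m => ‖c m‖ / ((m : ℝ) + 1))
    {x : ℝ} (hx : 0 < x) : DifferentiableOn ℂ (poleKernel c x) poleCompl :=
  (differentiable_ofReal_cpow_neg hx).differentiableOn.mul (differentiableOn_poleSeries hc)

theorem norm_ofReal_cpow_neg {x : ℝ} (hx : 0 < x) (s : ℂ) : ‖(x : ℂ) ^ (-s)‖ = x ^ (-s.re) := by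
  rw [Complex.norm_cpow_eq_rpow_re_of_pos hx, Complex.neg_re]

theorem exists_norm_poleKernel_le {c : ℕ → ℂ} (hc : Summable fun m => ‖c m‖ / ((m : ℝ) + 1))
    {x : ℝ} (hx : 0 < x) (hx1 : x < 1) {δ : ℝ} (hδ : 0 < δ) :
    ∃ C, 0 ≤ C ∧ ∀ s : ℂ, s.re ≤ 0 → (∀ m : ℕ, δ ≤ ‖s + m‖) →
      ‖poleKernel c x s‖ ≤ C * Real.exp (-Real.log x / 2 * s.re) := by
  -- Since `x^(-σ) = exp(2aσ)`, one factor `exp(aσ)` absorbs the linear growth of the series and the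
  -- other remains as decay.
  set a : ℝ := -Real.log x / 2 with ha
  have hapos : 0 < a := by
    have := Real.log_neg hx hx1
    rw [ha]; linarith
  set K := ∑' m, ‖c m‖ / ((m : ℝ) + 1)
  have hK : 0 ≤ K := tsum_nonneg fun m => by positivity
  refine ⟨K * (1 + (1 / a + 1) / δ), by positivity, fun s hs hd => ?_⟩
  have h1 : x ^ (-s.re) = Real.exp (a * s.re) * Real.exp (a * s.re) := by
    rw [Real.rpow_def_of_pos hx, ← Real.exp_add, ha]
    congr 1; ring
  have h2 : |s.re| * Real.exp (a * s.re) ≤ 1 / a := by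
    rw [abs_of_nonpos hs, le_div_iff₀ hapos]
    have h3 : -(a * s.re) ≤ Real.exp (-(a * s.re)) := by
      linarith [Real.add_one_le_exp (-(a * s.re))]
    calc -s.re * Real.exp (a * s.re) * a = -(a * s.re) * Real.exp (a * s.re) := by ring
      _ ≤ Real.exp (-(a * s.re)) * Real.exp (a * s.re) := by gcongr
      _ = 1 := by rw [← Real.exp_add]; simp
  have h4 : Real.exp (a * s.re) ≤ 1 := Real.exp_le_one_iff.2 (by nlinarith)
  rw [poleKernel, norm_mul, norm_ofReal_cpow_neg hx, h1]
  calc Real.exp (a * s.re) * Real.exp (a * s.re) * ‖poleSeries c s‖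
      ≤ Real.exp (a * s.re) * Real.exp (a * s.re) * (K * (1 + (|s.re| + 1) / δ)) := by
        gcongr; exact norm_poleSeries_le hc hδ hd
    _ = K * (Real.exp (a * s.re) + (|s.re| * Real.exp (a * s.re) + Real.exp (a * s.re)) / δ)
        * Real.exp (a * s.re) := by ring
    _ ≤ K * (1 + (1 / a + 1) / δ) * Real.exp (a * s.re) := by gcongr

/-! ### Residue sums over circles of half-integer radius -/

theorem half_le_norm_add_natCast {s : ℂ} {M : ℕ} (hs : ‖s‖ = M + 1 / 2) (m : ℕ) :
    1 / 2 ≤ ‖s + m‖ := by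
  have h1 := norm_sub_norm_le (s : ℂ) (-(m : ℂ))
  have h2 := norm_sub_norm_le (-(m : ℂ)) s
  have h3 : ‖-(m : ℂ) - s‖ = ‖s + m‖ := by rw [← norm_neg]; congr 1; ring
  rw [h3] at h2
  rw [sub_neg_eq_add] at h1
  simp only [norm_neg, Complex.norm_natCast] at h1 h2
  rcases le_or_gt m M with h | h
  · have : (m : ℝ) ≤ M := by exact_mod_cast h
    linarith
  · have : (M : ℝ) + 1 ≤ m := by exact_mod_cast h
    linarith

theorem circleIntegral_pole {x : ℝ} (hx : 0 < x) (a : ℂ) (M m : ℕ) :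
    (∮ z in C(0, (M : ℝ) + 1 / 2), (x : ℂ) ^ (-z) * (a / (z + m))) =
      if m ≤ M then 2 * Real.pi * Complex.I * (a * (x : ℂ) ^ m) else 0 := by
  have hd : Differentiable ℂ fun z : ℂ => a * (x : ℂ) ^ (-z) :=
    (differentiable_ofReal_cpow_neg hx).const_mul a
  split_ifs with h
  · have h1 : (m : ℝ) ≤ M := by exact_mod_cast h
    have := DiffContOnCl.circleIntegral_sub_inv_smul (c := 0) (R := (M : ℝ) + 1 / 2)
      (w := -(m : ℂ)) hd.diffContOnCl (by simp; linarith)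
    simp only [smul_eq_mul, neg_neg, Complex.cpow_natCast, sub_neg_eq_add] at this
    rw [← this]
    congr 1
    ext z
    ring
  · have h1 : (M : ℝ) + 1 ≤ m := by exact_mod_cast not_le.1 h
    refine DiffContOnCl.circleIntegral_eq_zero (by positivity) (DifferentiableOn.diffContOnCl ?_)
    intro z hz
    have hz' : z + m ≠ 0 := by
      intro he
      have h2 : ‖z‖ = m := by
        rw [eq_neg_of_add_eq_zero_left he]; simp
      have h3 := Metric.closure_ball_subset_closedBall hz
      rw [mem_closedBall_zero_iff, h2] at h3
      linarith
    have := differentiable_ofReal_cpow_neg hx z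
    exact DifferentiableAt.differentiableWithinAt (by fun_prop (disch := assumption))

theorem circleIntegral_poleKernel {c : ℕ → ℂ} (hc : Summable fun m => ‖c m‖ / ((m : ℝ) + 1))
    {x : ℝ} (hx : 0 < x) (hx1 : x < 1) (M : ℕ) :
    (∮ z in C(0, (M : ℝ) + 1 / 2), poleKernel c x z) =
      2 * Real.pi * Complex.I * ∑ m ∈ Finset.range (M + 1), c m * (x : ℂ) ^ m := by
  set R : ℝ := (M : ℝ) + 1 / 2 with hR
  have hRpos : 0 < R := by positivity
  have hnorm : ∀ θ, ‖circleMap 0 R θ‖ = M + 1 / 2 := fun θ => by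
    rw [norm_circleMap_zero, abs_of_pos hRpos]
  have hd := fun θ => half_le_norm_add_natCast (hnorm θ)
  have key : HasSum (fun m : ℕ => ∮ z in C(0, R), (x : ℂ) ^ (-z) * (c m / (z + m)))
      (∮ z in C(0, R), poleKernel c x z) := by
    -- On the circle `‖x^(-s)‖ ≤ x^(-R)` because `x < 1`, and the distance to the poles is at least
    -- `1/2`; this yields the dominating terms.
    refine intervalIntegral.hasSum_integral_of_dominated_convergence
      (fun m _ => R * (x ^ (-R) * (‖c m‖ / ((m : ℝ) + 1) * (1 + (R + 1) / (1 / 2)))))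
      (fun m => ?_) (fun m => ?_) ?_ ?_ ?_
    · refine Continuous.aestronglyMeasurable ?_
      have h1 : ∀ θ, circleMap 0 R θ + m ≠ 0 := fun θ =>
        norm_pos_iff.1 (lt_of_lt_of_le (by norm_num) (hd θ m))
      have h2 := (differentiable_ofReal_cpow_neg hx).continuous.comp (continuous_circleMap 0 R)
      have h3 := continuous_circleMap 0 R
      simp only [deriv_circleMap]
      exact (h3.mul continuous_const).smul
        (h2.mul (continuous_const.div (h3.add continuous_const) h1))
    · refine Eventually.of_forall fun θ _ => ?_
      have hre : |(circleMap 0 R θ).re| ≤ R := (Complex.abs_re_le_norm _).trans_eq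
        ((hnorm θ).trans hR.symm)
      rw [norm_smul, norm_mul, norm_ofReal_cpow_neg hx, deriv_circleMap, norm_mul, Complex.norm_I,
        mul_one, hnorm, ← hR]
      refine mul_le_mul_of_nonneg_left (mul_le_mul ?_ ?_ (norm_nonneg _) (by positivity)) hRpos.le
      · exact Real.rpow_le_rpow_of_exponent_ge hx hx1.le (by linarith [(abs_le.1 hre).2])
      · refine (norm_div_add_natCast_le c (by norm_num) (hd θ) m).trans ?_
        gcongr
    · exact Eventually.of_forall fun θ _ =>
        ((hc.mul_right _).mul_left _).mul_left _
    · simp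
    · refine Eventually.of_forall fun θ _ => ?_
      exact ((summable_div_add_natCast hc (by norm_num) (hd θ)).hasSum.mul_left _).const_smul _
  simp only [hR, circleIntegral_pole hx] at key
  rw [← hR] at key
  refine key.unique ?_
  have h2 := hasSum_sum_of_ne_finset_zero (s := Finset.range (M + 1))
    (L := SummationFilter.unconditional ℕ) (f := fun m : ℕ => if m ≤ M then 2 * Real.pi * Complex.I * (c m * (x : ℂ) ^ m) else 0)
    (fun m hm => if_neg (by simpa [Nat.lt_succ_iff] using hm))
  convert! h2 using 1
  rw [Finset.mul_sum]
  refine Finset.sum_congr rfl fun m hm => ?_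
  rw [if_pos (by simpa [Nat.lt_succ_iff] using hm)]

/-! ### Primitives on the slit plane and their limits at the left end -/

/-- The exponential maps the convex strip `|Im w| < π` onto the slit plane with inverse `log`. A
primitive of `f(exp w) exp w` exists on the strip, and composing it with `log` gives one of `f`. -/
theorem exists_hasDerivAt_slitPlane {f : ℂ → ℂ} (hf : DifferentiableOn ℂ f Complex.slitPlane) :
    ∃ F : ℂ → ℂ, ∀ s ∈ Complex.slitPlane, HasDerivAt F (f s) s := by
  set S : Set ℂ := {w | w.im ∈ Set.Ioo (-Real.pi) Real.pi} with hS
  have hSo : IsOpen S := isOpen_Ioo.preimage Complex.continuous_im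
  have hconv : Convex ℝ S := (convex_Ioo _ _).is_linear_preimage Complex.imLm.isLinear
  have hexp : ∀ w ∈ S, Complex.exp w ∈ Complex.slitPlane := by
    intro w hw
    rw [Complex.mem_slitPlane_iff_arg]
    refine ⟨?_, Complex.exp_ne_zero _⟩
    rw [Complex.arg_exp, (toIocMod_eq_self Real.two_pi_pos).2 ⟨hw.1, by linarith [hw.2]⟩]
    exact hw.2.ne
  have hd : DifferentiableOn ℂ (fun w => f (Complex.exp w) * Complex.exp w) S := by
    refine DifferentiableOn.mul ?_ Complex.differentiable_exp.differentiableOn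
    exact hf.comp Complex.differentiable_exp.differentiableOn hexp
  obtain ⟨H, hH⟩ := hconv.exists_forall_hasDerivWithinAt hd
  refine ⟨fun s => H (Complex.log s), fun s hs => ?_⟩
  have hmem : Complex.log s ∈ S := by
    rw [hS, Set.mem_ofPred_eq, Complex.log_im]
    exact ⟨Complex.neg_pi_lt_arg s, lt_of_le_of_ne (Complex.arg_le_pi s)
      (Complex.mem_slitPlane_iff_arg.1 hs).1⟩
  have h0 := Complex.slitPlane_ne_zero hs
  have := ((hH _ hmem).hasDerivAt (hSo.mem_nhds hmem)).comp s (Complex.hasDerivAt_log hs)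
  rwa [Complex.exp_log h0, mul_inv_cancel_right₀ h0] at this

theorem le_norm_add_natCast_of_im {s : ℂ} {δ : ℝ} (h : δ ≤ |s.im|) (m : ℕ) : δ ≤ ‖s + m‖ := by
  have := Complex.abs_im_le_norm (s + m)
  rw [Complex.add_im, Complex.natCast_im, add_zero] at this
  exact h.trans this

/-- Integration along a horizontal segment of a function of exponential decay to the left. -/
theorem norm_sub_le_of_horizontal {F f : ℂ → ℂ} {C a τ : ℝ} (ha : 0 < a) (hC : 0 ≤ C)
    (hF : ∀ σ : ℝ, HasDerivAt F (f ⟨σ, τ⟩) ⟨σ, τ⟩)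
    (hf : ∀ σ : ℝ, σ ≤ 0 → ‖f ⟨σ, τ⟩‖ ≤ C * Real.exp (a * σ)) {u v : ℝ} (huv : u ≤ v) (hv : v ≤ 0) :
    ‖F ⟨v, τ⟩ - F ⟨u, τ⟩‖ ≤ C / a * Real.exp (a * v) := by
  have hline : ∀ σ : ℝ, HasDerivAt (fun σ : ℝ => F ⟨σ, τ⟩) (f ⟨σ, τ⟩) σ := by
    intro σ
    have h1 : HasDerivAt (fun σ : ℝ => (⟨σ, τ⟩ : ℂ)) 1 σ := by
      have h2 := (Complex.ofRealCLM.hasDerivAt (x := σ)).add_const ((τ : ℂ) * Complex.I)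
      simpa [← Complex.mk_eq_add_mul_I] using h2
    have h3 := (hF σ).comp σ h1
    rw [mul_one] at h3
    exact h3
  have hB : ∀ σ : ℝ, HasDerivAt (fun σ : ℝ => C / a * Real.exp (a * σ)) (C * Real.exp (a * σ)) σ := by
    intro σ
    have := (((hasDerivAt_id σ).const_mul a).exp).const_mul (C / a)
    refine this.congr_deriv ?_
    rw [mul_one, div_mul_eq_mul_div, mul_comm (Real.exp _), ← mul_assoc, div_eq_iff ha.ne']
    simp only [id]
    ring
  refine image_norm_le_of_norm_deriv_right_le_deriv_boundary
    (f := fun σ : ℝ => F ⟨σ, τ⟩ - F ⟨u, τ⟩) (f' := fun σ => f ⟨σ, τ⟩) (a := u) (b := v)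
    (fun σ _ => ((hline σ).sub_const _).continuousAt.continuousWithinAt)
    (fun σ _ => ((hline σ).sub_const _).hasDerivWithinAt) (by simp; positivity) hB
    (fun σ hσ => hf σ (hσ.2.le.trans hv)) ⟨huv, le_rfl⟩

/-- A primitive, on the upper half-plane, of a function that decays exponentially to the left, has
a limit at the left end, uniformly away from the non-positive integers. -/
theorem exists_norm_sub_le_of_upperHalfPlane {F f : ℂ → ℂ} {a : ℝ} (ha : 0 < a)
    (hF : ∀ s : ℂ, 0 < s.im → HasDerivAt F (f s) s)
    (hf : ∀ δ : ℝ, 0 < δ → ∃ C, 0 ≤ C ∧ ∀ s : ℂ, s.re ≤ 0 → (∀ m : ℕ, δ ≤ ‖s + m‖) →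
      ‖f s‖ ≤ C * Real.exp (a * s.re)) :
    ∃ L : ℂ, ∀ δ : ℝ, 0 < δ → ∃ C, ∀ s : ℂ, 0 < s.im → s.re ≤ 0 → (∀ m : ℕ, δ ≤ ‖s + m‖) →
      ‖F s - L‖ ≤ C * Real.exp (a * s.re) := by
  -- At height at least `1` every pole is at distance at least `1`, so a single constant serves
  -- there; the limit is defined along the line `Im s = 1`.
  obtain ⟨C₁, hC₁, hb₁⟩ := hf 1 one_pos
  have hb : ∀ σ τ : ℝ, 1 ≤ τ → σ ≤ 0 → ‖f ⟨σ, τ⟩‖ ≤ C₁ * Real.exp (a * σ) := fun σ τ hτ hσ =>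
    hb₁ ⟨σ, τ⟩ hσ (le_norm_add_natCast_of_im (hτ.trans (le_abs_self τ)))
  have hhor : ∀ τ : ℝ, 1 ≤ τ → ∀ u v : ℝ, u ≤ v → v ≤ 0 →
      ‖F ⟨v, τ⟩ - F ⟨u, τ⟩‖ ≤ C₁ / a * Real.exp (a * v) := fun τ hτ u v huv hv =>
    norm_sub_le_of_horizontal ha hC₁ (fun σ => hF ⟨σ, τ⟩ (by show 0 < τ; linarith))
      (fun σ hσ => hb σ τ hτ hσ) huv hv
  have hexp : Tendsto (fun σ : ℝ => Real.exp (a * σ)) atBot (𝓝 0) :=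
    Real.tendsto_exp_atBot.comp (tendsto_id.const_mul_atBot ha)
  have hexpC : ∀ C : ℝ, Tendsto (fun σ : ℝ => C * Real.exp (a * σ)) atBot (𝓝 0) := fun C => by
    simpa using hexp.const_mul C
  obtain ⟨L, hL⟩ : ∃ L, Tendsto (fun σ : ℝ => F ⟨σ, 1⟩) atBot (𝓝 L) := by
    refine cauchy_map_iff_exists_tendsto.1 ?_
    rw [Metric.cauchy_iff]
    refine ⟨inferInstance, fun ε hε => ?_⟩
    obtain ⟨σ₀, hσ₀, hσ0⟩ := (((hexpC (C₁ / a)).eventually (gt_mem_nhds (half_pos hε))).and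
      (eventually_le_atBot 0)).exists
    refine ⟨(fun σ : ℝ => F ⟨σ, 1⟩) '' Set.Iic σ₀, image_mem_map (Iic_mem_atBot σ₀), ?_⟩
    rintro _ ⟨u, hu, rfl⟩ _ ⟨v, hv, rfl⟩
    have h1 := hhor 1 le_rfl u σ₀ hu hσ0
    have h2 := hhor 1 le_rfl v σ₀ hv hσ0
    rw [← dist_eq_norm, dist_comm] at h1
    rw [← dist_eq_norm] at h2
    linarith [dist_triangle (F ⟨u, 1⟩) (F ⟨σ₀, 1⟩) (F ⟨v, 1⟩)]
  have hvert : ∀ (τ τ' σ C : ℝ), 0 < τ → τ ≤ τ' → (∀ y ∈ Set.Icc τ τ', ‖f ⟨σ, y⟩‖ ≤ C) →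
      ‖F ⟨σ, τ'⟩ - F ⟨σ, τ⟩‖ ≤ C * (τ' - τ) := by
    intro τ τ' σ C hτ hττ hC
    refine norm_image_sub_le_of_norm_deriv_le_segment' (f := fun y : ℝ => F ⟨σ, y⟩)
      (f' := fun y => f ⟨σ, y⟩ * Complex.I) (fun y hy => ?_) (fun y hy => ?_) τ' ⟨hττ, le_rfl⟩
    · have h1 : HasDerivAt (fun y : ℝ => (⟨σ, y⟩ : ℂ)) Complex.I y := by
        have h2 := ((Complex.ofRealCLM.hasDerivAt (x := y)).mul_const Complex.I).const_add (σ : ℂ)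
        simpa [← Complex.mk_eq_add_mul_I] using h2
      exact ((hF ⟨σ, y⟩ (hτ.trans_le hy.1)).comp y h1).hasDerivWithinAt
    · simpa using hC y ⟨hy.1, hy.2.le⟩
  have hfar : ∀ σ τ : ℝ, 1 ≤ τ → σ ≤ 0 → ‖F ⟨σ, τ⟩ - L‖ ≤ C₁ / a * Real.exp (a * σ) := by
    intro σ τ hτ hσ
    -- The limit does not depend on the height: the vertical segment joining heights `1` and `τ`
    -- contributes at most `C₁ (τ - 1) exp(au)`.
    have hlim : Tendsto (fun u : ℝ => F ⟨u, τ⟩) atBot (𝓝 L) := by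
      have h0 : Tendsto (fun u : ℝ => F ⟨u, τ⟩ - F ⟨u, 1⟩) atBot (𝓝 0) := by
        refine squeeze_zero_norm' ?_ (hexpC (C₁ * (τ - 1)))
        filter_upwards [eventually_le_atBot 0] with u hu
        refine (hvert 1 τ u _ one_pos hτ fun y hy => hb u y hy.1 hu).trans_eq (by ring)
      simpa using h0.add hL
    refine le_of_tendsto (tendsto_const_nhds.sub hlim).norm ?_
    filter_upwards [eventually_le_atBot σ] with u hu
    exact hhor τ hτ u σ hu hσ
  refine ⟨L, fun δ hδ => ?_⟩
  obtain ⟨Cδ, hCδ, hbδ⟩ := hf δ hδ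
  refine ⟨Cδ + C₁ / a, fun s hs hre hd => ?_⟩
  rcases le_total 1 s.im with h | h
  · refine (hfar s.re s.im h hre).trans ?_
    gcongr
    linarith
  -- Below height `1`, climb vertically to it: moving up only increases the distance to the real
  -- poles, so the bound for `δ` holds along the segment.
  · have h1 := hvert s.im 1 s.re (Cδ * Real.exp (a * s.re)) hs h (fun y hy => by
      refine hbδ ⟨s.re, y⟩ hre fun m => (hd m).trans ?_
      rw [Complex.norm_eq_sqrt_sq_add_sq, Complex.norm_eq_sqrt_sq_add_sq]
      have : s.im ^ 2 ≤ y ^ 2 := pow_le_pow_left₀ hs.le hy.1 2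
      simp only [Complex.add_re, Complex.add_im, Complex.natCast_re, Complex.natCast_im, add_zero]
      gcongr)
    have h2 := hfar s.re 1 le_rfl hre
    rw [norm_sub_rev] at h1
    have h3 : Cδ * Real.exp (a * s.re) * (1 - s.im) ≤ Cδ * Real.exp (a * s.re) :=
      mul_le_of_le_one_right (by positivity) (by linarith)
    calc ‖F s - L‖ ≤ ‖F ⟨s.re, s.im⟩ - F ⟨s.re, 1⟩‖ + ‖F ⟨s.re, 1⟩ - L‖ :=
          norm_sub_le_norm_sub_add_norm_sub _ _ _
      _ ≤ _ := by rw [add_mul]; linarith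

/-- Complex conjugation reduces this to the upper half-plane, since the poles are real. -/
theorem exists_norm_sub_le_of_lowerHalfPlane {F f : ℂ → ℂ} {a : ℝ} (ha : 0 < a)
    (hF : ∀ s : ℂ, s.im < 0 → HasDerivAt F (f s) s)
    (hf : ∀ δ : ℝ, 0 < δ → ∃ C, 0 ≤ C ∧ ∀ s : ℂ, s.re ≤ 0 → (∀ m : ℕ, δ ≤ ‖s + m‖) →
      ‖f s‖ ≤ C * Real.exp (a * s.re)) :
    ∃ L : ℂ, ∀ δ : ℝ, 0 < δ → ∃ C, ∀ s : ℂ, s.im < 0 → s.re ≤ 0 → (∀ m : ℕ, δ ≤ ‖s + m‖) →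
      ‖F s - L‖ ≤ C * Real.exp (a * s.re) := by
  have hnorm : ∀ (s : ℂ) (m : ℕ), ‖(starRingEnd ℂ) s + m‖ = ‖s + m‖ := fun s m => by
    rw [← Complex.norm_conj]; simp
  obtain ⟨L, hL⟩ := exists_norm_sub_le_of_upperHalfPlane
    (F := fun s => starRingEnd ℂ (F (starRingEnd ℂ s)))
    (f := fun s => starRingEnd ℂ (f (starRingEnd ℂ s))) ha
    (fun s hs => by
      have := (hF (starRingEnd ℂ s) (by simpa using hs)).conj_conj
      rwa [Complex.conj_conj] at this)
    (fun δ hδ => by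
      obtain ⟨C, hC, h⟩ := hf δ hδ
      refine ⟨C, hC, fun s hs hd => ?_⟩
      rw [Complex.norm_conj]
      simpa using h (starRingEnd ℂ s) (by simpa using hs) (fun m => by rw [hnorm]; exact hd m))
  refine ⟨starRingEnd ℂ L, fun δ hδ => ?_⟩
  obtain ⟨C, h⟩ := hL δ hδ
  refine ⟨C, fun s him hre hd => ?_⟩
  have := h (starRingEnd ℂ s) (by simpa using him) (by simpa using hre)
    (fun m => by rw [hnorm]; exact hd m)
  simp only [Complex.conj_conj, Complex.conj_re] at this
  rw [← Complex.norm_conj]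
  simpa using this

theorem tendsto_intervalIntegral_symm {φ : ℝ → ℂ} (hφ : Continuous φ) (b : ℝ) :
    Tendsto (fun t => ∫ θ in -t..t, φ θ) (𝓝[<] b) (𝓝 (∫ θ in -b..b, φ θ)) := by
  have h : Continuous fun t => ∫ θ in (0 : ℝ)..t, φ θ :=
    intervalIntegral.continuous_primitive (fun a b => hφ.intervalIntegrable a b) 0
  have h2 : Continuous fun t => ∫ θ in -t..t, φ θ := by
    have : (fun t => ∫ θ in -t..t, φ θ) =
        fun t => (∫ θ in (0 : ℝ)..t, φ θ) - ∫ θ in (0 : ℝ)..(-t), φ θ := by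
      ext t
      rw [intervalIntegral.integral_interval_sub_left (hφ.intervalIntegrable _ _)
        (hφ.intervalIntegrable _ _)]
    rw [this]
    exact h.sub (h.comp continuous_neg)
  exact (h2.tendsto b).mono_left nhdsWithin_le_nhds

/-- The integral over a circle that crosses the negative axis at one point is close to the
difference of the limits of a primitive above and below the axis. -/
theorem norm_circleIntegral_sub_le {F f : ℂ → ℂ} {a C C' R : ℝ} {M : ℕ} (hR : R = M + 1 / 2)
    {L L' : ℂ} (hF : ∀ s ∈ Complex.slitPlane, HasDerivAt F (f s) s)
    (hf : ContinuousOn f poleCompl)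
    (hL : ∀ s : ℂ, 0 < s.im → s.re ≤ 0 → (∀ m : ℕ, 1 / 2 ≤ ‖s + m‖) →
      ‖F s - L‖ ≤ C * Real.exp (a * s.re))
    (hL' : ∀ s : ℂ, s.im < 0 → s.re ≤ 0 → (∀ m : ℕ, 1 / 2 ≤ ‖s + m‖) →
      ‖F s - L'‖ ≤ C' * Real.exp (a * s.re)) :
    ‖(∮ z in C(0, R), f z) - (L - L')‖ ≤ (C + C') * Real.exp (a * -R) := by
  have hRpos : 0 < R := by rw [hR]; positivity
  have hd : ∀ θ (m : ℕ), 1 / 2 ≤ ‖circleMap 0 R θ + m‖ := fun θ => half_le_norm_add_natCast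
    (M := M) (by rw [norm_circleMap_zero, abs_of_pos hRpos, hR])
  set φ : ℝ → ℂ := fun θ => deriv (circleMap 0 R) θ • f (circleMap 0 R θ) with hφdef
  have hφ : Continuous φ := by
    have h1 : Continuous fun θ => f (circleMap 0 R θ) :=
      hf.comp_continuous (continuous_circleMap 0 R) fun θ m =>
        norm_pos_iff.1 (lt_of_lt_of_le (by norm_num) (hd θ m))
    have h2 : Continuous fun θ => deriv (circleMap 0 R) θ := by
      simp only [deriv_circleMap]
      exact (continuous_circleMap 0 R).mul continuous_const
    exact h2.smul h1
  have hper : Function.Periodic φ (2 * Real.pi) := fun θ => by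
    simp only [hφdef, deriv_circleMap, periodic_circleMap 0 R θ]
  -- Recentring the parameter interval puts the crossing of the slit at its two ends.
  have hcirc : (∮ z in C(0, R), f z) = ∫ θ in -Real.pi..Real.pi, φ θ := by
    have := hper.intervalIntegral_add_eq 0 (-Real.pi)
    rw [zero_add, show -Real.pi + 2 * Real.pi = Real.pi by ring] at this
    exact this
  have hre : ∀ θ, (circleMap 0 R θ).re = R * Real.cos θ := fun θ => by
    simp [circleMap, Complex.exp_re]
  have him : ∀ θ, (circleMap 0 R θ).im = R * Real.sin θ := fun θ => by
    simp [circleMap, Complex.exp_im]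
  rw [hcirc]
  have hlim := ((tendsto_intervalIntegral_symm hφ Real.pi).sub_const (L - L')).norm
  have hlim2 : Tendsto (fun t => (C + C') * Real.exp (a * (R * Real.cos t))) (𝓝[<] Real.pi)
      (𝓝 ((C + C') * Real.exp (a * -R))) := by
    have h : Continuous fun t => (C + C') * Real.exp (a * (R * Real.cos t)) := by fun_prop
    have := h.tendsto Real.pi
    rw [Real.cos_pi, mul_neg_one] at this
    exact this.mono_left nhdsWithin_le_nhds
  -- `F` is no primitive at the crossing point `-R`, so the estimate is made on arcs `[-t, t]` with
  -- `t < π` and passed to the limit.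
  refine le_of_tendsto_of_tendsto hlim hlim2 ?_
  filter_upwards [Ioo_mem_nhdsLT (show Real.pi / 2 < Real.pi by linarith [Real.pi_pos])] with t ht
  have hpi := Real.pi_pos
  have hcos : Real.cos t ≤ 0 := Real.cos_nonpos_of_pi_div_two_le_of_le ht.1.le (by linarith [ht.2])
  have hsin : 0 < Real.sin t := Real.sin_pos_of_pos_of_lt_pi (by linarith [ht.1]) ht.2
  have hint : ∫ θ in -t..t, φ θ = F (circleMap 0 R t) - F (circleMap 0 R (-t)) := by
    refine intervalIntegral.integral_eq_sub_of_hasDerivAt (f := fun θ => F (circleMap 0 R θ))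
      (fun θ hθ => ?_) (hφ.intervalIntegrable _ _)
    rw [Set.uIcc_of_le (by linarith [ht.1])] at hθ
    have hslit : circleMap 0 R θ ∈ Complex.slitPlane := by
      rw [Complex.mem_slitPlane_iff, hre, him]
      rcases lt_trichotomy θ 0 with h | h | h
      · right
        exact (mul_neg_of_pos_of_neg hRpos
          (Real.sin_neg_of_neg_of_neg_pi_lt h (by linarith [hθ.1, ht.2]))).ne
      · left
        rw [h, Real.cos_zero, mul_one]; exact hRpos
      · right
        exact (mul_pos hRpos (Real.sin_pos_of_pos_of_lt_pi h (by linarith [hθ.2, ht.2]))).ne'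
    have h1 := (hF _ hslit).comp θ (hasDerivAt_circleMap 0 R θ)
    simp only [hφdef, deriv_circleMap, smul_eq_mul]
    rw [mul_comm]
    exact h1
  have h1 := hL (circleMap 0 R t) (by rw [him]; positivity)
    (by rw [hre]; exact mul_nonpos_of_nonneg_of_nonpos hRpos.le hcos) (hd t)
  have h2 := hL' (circleMap 0 R (-t))
    (by rw [him, Real.sin_neg]; exact mul_neg_of_pos_of_neg hRpos (neg_neg_of_pos hsin))
    (by rw [hre, Real.cos_neg]; exact mul_nonpos_of_nonneg_of_nonpos hRpos.le hcos) (hd (-t))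
  rw [hre] at h1 h2
  rw [Real.cos_neg] at h2
  rw [hint, add_mul]
  calc ‖F (circleMap 0 R t) - F (circleMap 0 R (-t)) - (L - L')‖
      = ‖(F (circleMap 0 R t) - L) - (F (circleMap 0 R (-t)) - L')‖ := by congr 1; ring
    _ ≤ _ := (norm_sub_le _ _).trans (add_le_add h1 h2)

/-- A primitive of the kernel on the slit plane has limits at the left end above and below the
slit, and their difference is given by the sum of all residues. -/
theorem exists_primitive_poleKernel {c : ℕ → ℂ} (hc : Summable fun m => ‖c m‖ / ((m : ℝ) + 1))
    {x : ℝ} (hx : 0 < x) (hx1 : x < 1) {S : ℂ} (hS : HasSum (fun m => c m * (x : ℂ) ^ m) S) :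
    ∃ (F : ℂ → ℂ) (L L' : ℂ) (a : ℝ), 0 < a ∧
      (∀ s ∈ Complex.slitPlane, HasDerivAt F (poleKernel c x s) s) ∧
      (∀ δ : ℝ, 0 < δ → ∃ C, ∀ s : ℂ, 0 < s.im → s.re ≤ 0 → (∀ m : ℕ, δ ≤ ‖s + m‖) →
        ‖F s - L‖ ≤ C * Real.exp (a * s.re)) ∧
      (∀ δ : ℝ, 0 < δ → ∃ C, ∀ s : ℂ, s.im < 0 → s.re ≤ 0 → (∀ m : ℕ, δ ≤ ‖s + m‖) →
        ‖F s - L'‖ ≤ C * Real.exp (a * s.re)) ∧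
      L - L' = 2 * Real.pi * Complex.I * S := by
  have hdiff := differentiableOn_poleKernel hc hx
  obtain ⟨F, hF⟩ := exists_hasDerivAt_slitPlane (hdiff.mono slitPlane_subset_poleCompl)
  have ha : 0 < -Real.log x / 2 := by linarith [Real.log_neg hx hx1]
  have hbound := fun (δ : ℝ) (hδ : 0 < δ) => exists_norm_poleKernel_le hc hx hx1 hδ
  obtain ⟨L, hL⟩ := exists_norm_sub_le_of_upperHalfPlane ha
    (fun s hs => hF s (Complex.mem_slitPlane_iff.2 (Or.inr hs.ne'))) hbound
  obtain ⟨L', hL'⟩ := exists_norm_sub_le_of_lowerHalfPlane ha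
    (fun s hs => hF s (Complex.mem_slitPlane_iff.2 (Or.inr hs.ne))) hbound
  refine ⟨F, L, L', _, ha, hF, hL, hL', ?_⟩
  obtain ⟨C, hC⟩ := hL (1 / 2) (by norm_num)
  obtain ⟨C', hC'⟩ := hL' (1 / 2) (by norm_num)
  have h1 : Tendsto (fun M : ℕ => ∮ z in C(0, (M : ℝ) + 1 / 2), poleKernel c x z) atTop
      (𝓝 (L - L')) := by
    rw [tendsto_iff_norm_sub_tendsto_zero]
    refine squeeze_zero (fun _ => norm_nonneg _) (fun M =>
      norm_circleIntegral_sub_le rfl hF hdiff.continuousOn hC hC') ?_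
    rw [← mul_zero (C + C')]
    refine (Real.tendsto_exp_atBot.comp ?_).const_mul _
    refine Tendsto.const_mul_atBot ha (tendsto_neg_atTop_atBot.comp ?_)
    exact tendsto_atTop_add_const_right _ _ tendsto_natCast_atTop_atTop
  refine tendsto_nhds_unique h1 ?_
  simp only [circleIntegral_poleKernel hc hx hx1]
  exact ((hS.tendsto_sum_nat.comp (tendsto_add_atTop_nat 1)).const_mul _)

/-! ### Integrals over loop contours -/

theorem IsLoopContour.mem_slitPlane {γ : ℝ → ℂ} (hγ : IsLoopContour γ) (t : ℝ) :
    γ t ∈ Complex.slitPlane := by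
  rw [Complex.mem_slitPlane_iff]
  by_contra! h
  exact hγ.notMem_axis t ⟨(γ t).re, h.1, Complex.ext rfl h.2.symm⟩

theorem IsLoopContour.integral_eq_sub {γ : ℝ → ℂ} (hγ : IsLoopContour γ) {F f : ℂ → ℂ}
    (hF : ∀ s ∈ Complex.slitPlane, HasDerivAt F (f s) s)
    (hf : ContinuousOn f Complex.slitPlane) (u v : ℝ) :
    ∫ t in u..v, f (γ t) * deriv γ t = F (γ v) - F (γ u) := by
  obtain ⟨D, hD, hdiff⟩ := hγ.differentiable
  refine MeasureTheory.integral_eq_of_hasDerivAt_off_countable (fun t => F (γ t)) _ hD ?_ ?_ ?_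
  · exact fun t _ => ((hF _ (hγ.mem_slitPlane t)).continuousAt.comp
      hγ.continuous.continuousAt).continuousWithinAt
  · exact fun t ht => (hF _ (hγ.mem_slitPlane t)).comp t (hdiff t ht.2).hasDerivAt
  · have h1 : IntervalIntegrable (deriv γ) MeasureTheory.volume u v :=
      (hγ.locallyIntegrable_deriv.integrableOn_isCompact isCompact_uIcc).intervalIntegrable
    exact h1.continuousOn_mul (hf.comp_continuous hγ.continuous hγ.mem_slitPlane).continuousOn

/-- A contour may come arbitrarily close to the poles, where the bounds on `F` are lost. By the
intermediate value theorem its real part still takes values midway between poles at arbitrarily late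
parameters. -/
theorem exists_eq_neg_natCast_add_half {r : ℝ → ℝ} (hr : Continuous r)
    (hlim : Tendsto r atTop atBot) (k : ℕ) :
    ∃ T : ℝ, (k : ℝ) ≤ T ∧ ∃ M : ℕ, r T = -((M : ℝ) + 1 / 2) := by
  obtain ⟨M, hM⟩ := exists_nat_gt (-r k)
  obtain ⟨T, hT, hkT⟩ := ((hlim.eventually_le_atBot (-((M : ℝ) + 1 / 2))).and
    (eventually_ge_atTop (k : ℝ))).exists
  obtain ⟨t, ht, hrt⟩ := intermediate_value_Icc' hkT hr.continuousOn
    (show -((M : ℝ) + 1 / 2) ∈ Set.Icc (r T) (r k) from ⟨hT, by linarith⟩)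
  exact ⟨t, ht.1, M, hrt⟩

theorem half_le_norm_add_natCast_of_re {s : ℂ} {M : ℕ} (hs : s.re = -((M : ℝ) + 1 / 2)) (m : ℕ) :
    1 / 2 ≤ ‖s + m‖ := by
  have h := Complex.abs_re_le_norm (s + m)
  rw [Complex.add_re, Complex.natCast_re, hs] at h
  refine le_trans ?_ h
  rcases le_or_gt m M with hm | hm
  · have : (m : ℝ) ≤ M := by exact_mod_cast hm
    rw [le_abs]; right; linarith
  · have : (M : ℝ) + 1 ≤ m := by exact_mod_cast hm
    rw [le_abs]; left; linarith

/-- The sum of residues over a loop contour: convergence away from the half-line. -/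
theorem IsLoopContour.hasContourIntegral_poleKernel {γ : ℝ → ℂ} (hγ : IsLoopContour γ)
    {c : ℕ → ℂ} (hc : Summable fun m => ‖c m‖ / ((m : ℝ) + 1))
    {x : ℝ} (hx : 0 < x) (hx1 : x < 1) {S : ℂ} (hS : HasSum (fun m => c m * (x : ℂ) ^ m) S)
    {δ : ℝ} (hδ : 0 < δ) (hdist : ∀ t, δ ≤ Metric.infDist (γ t) nonposAxis) :
    HasContourIntegral (poleKernel c x) γ (2 * Real.pi * Complex.I * S) := by
  obtain ⟨F, L, L', a, ha, hF, hL, hL', hLL⟩ := exists_primitive_poleKernel hc hx hx1 hS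
  have hcont : ContinuousOn (poleKernel c x) Complex.slitPlane :=
    (differentiableOn_poleKernel hc hx).continuousOn.mono slitPlane_subset_poleCompl
  have hd : ∀ t (m : ℕ), δ ≤ ‖γ t + m‖ := fun t m => by
    have h := Metric.infDist_le_dist_of_mem (x := γ t)
      (show (-(m : ℂ)) ∈ nonposAxis from ⟨-(m : ℝ), by simp, by simp⟩)
    rw [dist_eq_norm, sub_neg_eq_add] at h
    exact (hdist t).trans h
  obtain ⟨C, hC⟩ := hL δ hδ
  obtain ⟨C', hC'⟩ := hL' δ hδ
  have hexp : ∀ (C : ℝ) {l : Filter ℝ}, Tendsto (fun t => (γ t).re) l atBot →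
      Tendsto (fun t => C * Real.exp (a * (γ t).re)) l (𝓝 0) := fun C l h => by
    rw [← mul_zero C]
    exact (Real.tendsto_exp_atBot.comp (h.const_mul_atBot ha)).const_mul C
  have htop : Tendsto (fun t => F (γ t)) atTop (𝓝 L) := by
    rw [tendsto_iff_norm_sub_tendsto_zero]
    refine squeeze_zero' (Eventually.of_forall fun _ => norm_nonneg _) ?_ (hexp C hγ.re_atTop)
    filter_upwards [hγ.im_atTop, hγ.re_atTop.eventually_le_atBot 0] with t h1 h2
    exact hC _ h1 h2 (hd t)
  have hbot : Tendsto (fun t => F (γ t)) atBot (𝓝 L') := by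
    rw [tendsto_iff_norm_sub_tendsto_zero]
    refine squeeze_zero' (Eventually.of_forall fun _ => norm_nonneg _) ?_ (hexp C' hγ.re_atBot)
    filter_upwards [hγ.im_atBot, hγ.re_atBot.eventually_le_atBot 0] with t h1 h2
    exact hC' _ h1 h2 (hd t)
  rw [HasContourIntegral, ← hLL]
  simp only [hγ.integral_eq_sub hF hcont]
  exact (htop.comp tendsto_snd).sub (hbot.comp tendsto_fst)

/-- The sum of residues over a loop contour: the value of a convergent integral. -/
theorem IsLoopContour.eq_of_hasContourIntegral_poleKernel {γ : ℝ → ℂ} (hγ : IsLoopContour γ)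
    {c : ℕ → ℂ} (hc : Summable fun m => ‖c m‖ / ((m : ℝ) + 1))
    {x : ℝ} (hx : 0 < x) (hx1 : x < 1) {S : ℂ} (hS : HasSum (fun m => c m * (x : ℂ) ^ m) S)
    {I : ℂ} (hI : HasContourIntegral (poleKernel c x) γ I) :
    I = 2 * Real.pi * Complex.I * S := by
  obtain ⟨F, L, L', a, ha, hF, hL, hL', hLL⟩ := exists_primitive_poleKernel hc hx hx1 hS
  have hcont : ContinuousOn (poleKernel c x) Complex.slitPlane :=
    (differentiableOn_poleKernel hc hx).continuousOn.mono slitPlane_subset_poleCompl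
  obtain ⟨C, hC⟩ := hL (1 / 2) (by norm_num)
  obtain ⟨C', hC'⟩ := hL' (1 / 2) (by norm_num)
  have hre : Continuous fun t => (γ t).re := Complex.continuous_re.comp hγ.continuous
  -- Convergence is assumed here, so the limit may be computed along parameters with `Re γ = -(M +
  -- 1/2)`, at distance at least `1/2` from the poles.
  choose T hT M hTM using exists_eq_neg_natCast_add_half hre hγ.re_atTop
  choose T' hT' M' hTM' using exists_eq_neg_natCast_add_half (hre.comp continuous_neg)
    (hγ.re_atBot.comp tendsto_neg_atTop_atBot)
  simp only [Function.comp_apply] at hTM'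
  have hTlim : Tendsto T atTop atTop := tendsto_atTop_mono hT tendsto_natCast_atTop_atTop
  have hTlim' : Tendsto (fun k => -T' k) atTop atBot :=
    tendsto_neg_atTop_atBot.comp (tendsto_atTop_mono hT' tendsto_natCast_atTop_atTop)
  have hexp : ∀ (C : ℝ) (u : ℕ → ℝ), Tendsto (fun k => (γ (u k)).re) atTop atBot →
      Tendsto (fun k => C * Real.exp (a * (γ (u k)).re)) atTop (𝓝 0) := fun C u h => by
    rw [← mul_zero C]
    exact (Real.tendsto_exp_atBot.comp (h.const_mul_atBot ha)).const_mul C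
  have htop : Tendsto (fun k => F (γ (T k))) atTop (𝓝 L) := by
    rw [tendsto_iff_norm_sub_tendsto_zero]
    refine squeeze_zero' (Eventually.of_forall fun _ => norm_nonneg _) ?_
      (hexp C T (hγ.re_atTop.comp hTlim))
    filter_upwards [hTlim.eventually hγ.im_atTop,
      hTlim.eventually (hγ.re_atTop.eventually_le_atBot 0)] with k h1 h2
    exact hC _ h1 h2 (half_le_norm_add_natCast_of_re (hTM k))
  have hbot : Tendsto (fun k => F (γ (-T' k))) atTop (𝓝 L') := by
    rw [tendsto_iff_norm_sub_tendsto_zero]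
    refine squeeze_zero' (Eventually.of_forall fun _ => norm_nonneg _) ?_
      (hexp C' (fun k => -T' k) (hγ.re_atBot.comp hTlim'))
    filter_upwards [hTlim'.eventually hγ.im_atBot,
      hTlim'.eventually (hγ.re_atBot.eventually_le_atBot 0)] with k h1 h2
    exact hC' _ h1 h2 (half_le_norm_add_natCast_of_re (hTM' k))
  rw [HasContourIntegral] at hI
  simp only [hγ.integral_eq_sub hF hcont] at hI
  rw [← hLL]
  exact tendsto_nhds_unique (hI.comp (hTlim'.prodMk hTlim)) (htop.sub hbot)

/-! ### The binomial series and the Beta integral -/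

/-- The Taylor coefficients at `0` of `(1 - u) ^ b`. -/
noncomputable def oneSubRpowCoeff (b : ℝ) (j : ℕ) : ℝ := (-1) ^ j * Ring.choose b j

theorem hasSum_oneSubRpowCoeff (b : ℝ) {u : ℝ} (hu0 : 0 ≤ u) (hu1 : u < 1) :
    HasSum (fun j => oneSubRpowCoeff b j * u ^ j) ((1 - u) ^ b) := by
  have h := Real.one_add_rpow_hasFPowerSeriesOnBall_zero (a := b) |>.hasSum (y := -u) (by
    rw [Metric.mem_eball, edist_dist, ENNReal.ofReal_lt_one, dist_zero_right, norm_neg,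
      Real.norm_of_nonneg hu0]
    exact hu1)
  rw [zero_add, ← sub_eq_add_neg] at h
  convert! h using 2 with j
  rw [binomialSeries_apply, List.ofFn_const, List.prod_replicate, neg_pow, smul_eq_mul,
    oneSubRpowCoeff]
  ring

theorem oneSubRpowCoeff_succ (b : ℝ) (j : ℕ) :
    oneSubRpowCoeff b (j + 1) * (j + 1) = oneSubRpowCoeff b j * (j - b) := by
  have h : Ring.choose b (j + 1) * (j + 1) = Ring.choose b j * (b - j) := by
    rw [Ring.choose_eq_smul, Ring.choose_eq_smul, descPochhammer_succ_right,
      Polynomial.smeval_mul, Polynomial.smeval_sub, Polynomial.smeval_X, Polynomial.smeval_natCast,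
      Nat.factorial_succ]
    have : (j.factorial : ℝ) ≠ 0 := by positivity
    have : (j : ℝ) + 1 ≠ 0 := by positivity
    push_cast
    simp only [smul_eq_mul, pow_one, pow_zero, nsmul_eq_mul, mul_one]
    field_simp
  rw [oneSubRpowCoeff, oneSubRpowCoeff, pow_succ]
  linear_combination (-(-1) ^ j) * h

/-- For indices beyond `b` the recurrence has constant sign and telescopes: `|c_j| / (j + 1) =
(|c_j| - |c_{j+1}|) / (b + 1)`. This is where `b > -1` enters. -/
theorem summable_abs_oneSubRpowCoeff_div {b : ℝ} (hb : -1 < b) :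
    Summable fun j => |oneSubRpowCoeff b j| / ((j : ℝ) + 1) := by
  obtain ⟨J, hJ⟩ := exists_nat_gt b
  have hb1 : 0 < b + 1 := by linarith
  set d : ℕ → ℝ := fun j => |oneSubRpowCoeff b (j + J)| with hd
  have hstep : ∀ j, d j / (((j + J : ℕ) : ℝ) + 1) = (d j - d (j + 1)) / (b + 1) := by
    intro j
    have h := congrArg abs (oneSubRpowCoeff_succ b (j + J))
    have hj : b ≤ ((j + J : ℕ) : ℝ) := by push_cast; have := Nat.cast_nonneg (α := ℝ) j; linarith
    have hj1 : (0 : ℝ) < ((j + J : ℕ) : ℝ) + 1 := by positivity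
    rw [abs_mul, abs_mul, abs_of_pos hj1, abs_of_nonneg (by linarith : (0 : ℝ) ≤ _ - b)] at h
    have h' : d (j + 1) * (((j + J : ℕ) : ℝ) + 1) = d j * (((j + J : ℕ) : ℝ) - b) := by
      simp only [hd]
      rw [← h, show j + 1 + J = j + J + 1 by ring]
    rw [div_eq_div_iff hj1.ne' hb1.ne']
    linear_combination h'
  refine (summable_nat_add_iff J).1 ?_
  refine summable_of_sum_range_le (c := d 0 / (b + 1)) (fun j => by positivity) fun k => ?_
  have : ∀ j, |oneSubRpowCoeff b (j + J)| / (((j + J : ℕ) : ℝ) + 1) = (d j - d (j + 1)) / (b + 1) :=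
    hstep
  rw [Finset.sum_congr rfl fun j _ => this j, ← Finset.sum_div, Finset.sum_range_sub']
  have : 0 ≤ d k := abs_nonneg _
  gcongr
  linarith

/-- Expand `(1 - u)^b` and integrate term by term against `u^(s-1)`; the norms integrate to `|c_j| /
(Re s + j)`, comparable to the summable `|c_j| / (j + 1)`. -/
theorem hasSum_betaIntegral {b : ℝ} (hb : -1 < b) {s : ℂ} (hs : 0 < s.re) :
    HasSum (fun j : ℕ => (oneSubRpowCoeff b j : ℂ) / (s + j)) (Complex.betaIntegral s (b + 1)) := by
  set F : ℕ → ℝ → ℂ := fun j u => (oneSubRpowCoeff b j : ℂ) * (u : ℂ) ^ (s - 1 + j)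
  have hre : ∀ j : ℕ, -1 < (s - 1 + j).re := fun j => by
    simp only [Complex.add_re, Complex.sub_re, Complex.one_re, Complex.natCast_re]
    have := Nat.cast_nonneg (α := ℝ) j
    linarith
  have hint : ∀ j, MeasureTheory.Integrable (F j)
      (MeasureTheory.volume.restrict (Set.Ioo (0 : ℝ) 1)) := fun j =>
    (((intervalIntegrable_iff_integrableOn_Ioo_of_le zero_le_one).1
      (intervalIntegral.intervalIntegrable_cpow' (hre j)))).const_mul _
  have hval : ∀ j, ∫ u in Set.Ioo (0 : ℝ) 1, F j u = (oneSubRpowCoeff b j : ℂ) / (s + j) := by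
    intro j
    have hne : s + j ≠ 0 := fun h => by
      have := congrArg Complex.re h
      simp only [Complex.add_re, Complex.natCast_re, Complex.zero_re] at this
      have := Nat.cast_nonneg (α := ℝ) j
      linarith
    have h1 : s - 1 + j + 1 = s + j := by ring
    rw [← MeasureTheory.integral_Ioc_eq_integral_Ioo, ← intervalIntegral.integral_of_le zero_le_one,
      intervalIntegral.integral_const_mul, integral_cpow (Or.inl (hre j)), h1]
    simp [Complex.zero_cpow hne, div_eq_mul_inv]
  have hnorm : ∀ j, ∫ u in Set.Ioo (0 : ℝ) 1, ‖F j u‖ = |oneSubRpowCoeff b j| / (s.re + j) := by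
    intro j
    have h1 : s.re - 1 + j + 1 = s.re + j := by ring
    have h2 : s.re + j ≠ 0 := by positivity
    have h3 := hre j
    simp only [Complex.add_re, Complex.sub_re, Complex.one_re, Complex.natCast_re] at h3
    have : Set.EqOn (fun u : ℝ => ‖F j u‖) (fun u => |oneSubRpowCoeff b j| * u ^ (s.re - 1 + j))
        (Set.Ioo 0 1) := fun u hu => by
      simp only [F, norm_mul, Complex.norm_real, Real.norm_eq_abs,
        Complex.norm_cpow_eq_rpow_re_of_pos hu.1, Complex.add_re, Complex.sub_re, Complex.one_re,
        Complex.natCast_re]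
    rw [MeasureTheory.setIntegral_congr_fun measurableSet_Ioo this,
      ← MeasureTheory.integral_Ioc_eq_integral_Ioo, ← intervalIntegral.integral_of_le zero_le_one,
      intervalIntegral.integral_const_mul, integral_rpow (Or.inl h3), h1]
    simp [Real.zero_rpow h2, div_eq_mul_inv]
  have hsum : Summable fun j => ∫ u in Set.Ioo (0 : ℝ) 1, ‖F j u‖ := by
    simp only [hnorm]
    refine Summable.of_nonneg_of_le (fun j => by positivity) (fun j => ?_)
      ((summable_abs_oneSubRpowCoeff_div hb).mul_left (1 + 1 / s.re))
    have h1 : (j : ℝ) + 1 ≤ (1 + 1 / s.re) * (s.re + j) := by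
      have : (1 + 1 / s.re) * (s.re + j) = s.re + j + 1 + j / s.re := by field_simp; ring
      rw [this]
      have : 0 ≤ (j : ℝ) / s.re := by positivity
      linarith
    rw [mul_div_assoc', div_le_div_iff₀ (by positivity) (by positivity)]
    calc |oneSubRpowCoeff b j| * ((j : ℝ) + 1)
        ≤ |oneSubRpowCoeff b j| * ((1 + 1 / s.re) * (s.re + j)) := by gcongr
      _ = _ := by ring
  have key := MeasureTheory.hasSum_integral_of_summable_integral_norm hint hsum
  simp only [hval] at key
  convert! key using 1
  rw [Complex.betaIntegral, intervalIntegral.integral_of_le zero_le_one,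
    MeasureTheory.integral_Ioc_eq_integral_Ioo]
  refine MeasureTheory.setIntegral_congr_fun measurableSet_Ioo fun u hu => ?_
  have hu0 : (u : ℂ) ≠ 0 := by exact_mod_cast hu.1.ne'
  have h1 := (Complex.hasSum_ofReal.2 (hasSum_oneSubRpowCoeff b hu.1.le hu.2)).mul_left
    ((u : ℂ) ^ (s - 1))
  have h2 : ∀ j : ℕ, (u : ℂ) ^ (s - 1) * ((oneSubRpowCoeff b j * u ^ j : ℝ) : ℂ) = F j u := by
    intro j
    simp only [F]
    rw [Complex.cpow_add _ _ hu0, Complex.cpow_natCast]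
    push_cast
    ring
  simp only [h2] at h1
  rw [h1.tsum_eq, add_sub_cancel_right, Complex.ofReal_cpow (by linarith [hu.2])]
  push_cast
  rfl

theorem Complex.differentiableOn_Gamma_poleCompl : DifferentiableOn ℂ Complex.Gamma poleCompl :=
  fun s hs => (Complex.differentiableAt_Gamma s fun m he =>
    hs m (by rw [he]; ring)).differentiableWithinAt

/-- For `Re s > 0` this is the Beta integral; the identity theorem extends it to the connected slit
plane. -/
theorem poleSeries_oneSubRpowCoeff {b : ℝ} (hb : -1 < b) {s : ℂ} (hs : s ∈ Complex.slitPlane) :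
    poleSeries (fun j => (oneSubRpowCoeff b j : ℂ)) s =
      Complex.Gamma (b + 1) * (Complex.Gamma s * (Complex.Gamma (s + (b + 1)))⁻¹) := by
  have hc : Summable fun m => ‖(oneSubRpowCoeff b m : ℂ)‖ / ((m : ℝ) + 1) := by
    simpa only [Complex.norm_real, Real.norm_eq_abs] using summable_abs_oneSubRpowCoeff_div hb
  have h1 : DifferentiableOn ℂ (poleSeries fun j => (oneSubRpowCoeff b j : ℂ)) Complex.slitPlane :=
    (differentiableOn_poleSeries hc).mono slitPlane_subset_poleCompl
  have h2 : DifferentiableOn ℂ (fun s : ℂ =>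
      Complex.Gamma (b + 1) * (Complex.Gamma s * (Complex.Gamma (s + (b + 1)))⁻¹))
      Complex.slitPlane := by
    refine DifferentiableOn.const_mul (DifferentiableOn.mul
      (Complex.differentiableOn_Gamma_poleCompl.mono slitPlane_subset_poleCompl) ?_) _
    exact (Complex.differentiable_one_div_Gamma.comp (by fun_prop : Differentiable ℂ
      fun s : ℂ => s + (b + 1))).differentiableOn
  refine (h1.analyticOnNhd Complex.isOpen_slitPlane).eqOn_of_preconnected_of_eventuallyEq
    (h2.analyticOnNhd Complex.isOpen_slitPlane)
    (Complex.starConvex_one_slitPlane.isPathConnected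
      Complex.one_mem_slitPlane).isConnected.isPreconnected
    Complex.one_mem_slitPlane ?_ hs
  filter_upwards [(isOpen_lt continuous_const Complex.continuous_re).mem_nhds
    (show (0 : ℝ) < (1 : ℂ).re by simp)] with w hw
  rw [poleSeries, (hasSum_betaIntegral hb hw).tsum_eq,
    Complex.betaIntegral_eq_Gamma_mul_div _ _ hw (by simp; linarith)]
  ring

/-! ### Taylor coefficients of the weighted polynomial -/

/-- The Taylor coefficients at `0` of `P u * (1 - u) ^ b`. -/
noncomputable def jacobiCoeff (P : Polynomial ℝ) (b : ℝ) (m : ℕ) : ℂ :=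
  ∑ k ∈ Finset.range (P.natDegree + 1),
    (P.coeff k : ℂ) * (if k ≤ m then (oneSubRpowCoeff b (m - k) : ℂ) else 0)

theorem hasSum_ite_le_sub {a w : ℕ → ℂ} {A : ℂ} (k : ℕ) (h : HasSum (fun j => a j * w (j + k)) A) :
    HasSum (fun m => (if k ≤ m then a (m - k) else 0) * w m) A := by
  refine ((add_left_injective k).hasSum_iff fun m hm => ?_).1 ?_
  · rw [if_neg, zero_mul]
    exact fun hkm => hm ⟨m - k, Nat.sub_add_cancel hkm⟩
  · simpa [Function.comp_def] using h

/-- Used twice: `w m = x^m` gives the Taylor expansion, `w m = 1 / (s + m)` the pole series. -/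
theorem hasSum_jacobiCoeff_mul (P : Polynomial ℝ) (b : ℝ) {w A : ℕ → ℂ}
    (h : ∀ k, HasSum (fun j => (oneSubRpowCoeff b j : ℂ) * w (j + k)) (A k)) :
    HasSum (fun m => jacobiCoeff P b m * w m)
      (∑ k ∈ Finset.range (P.natDegree + 1), (P.coeff k : ℂ) * A k) := by
  simp only [jacobiCoeff, Finset.sum_mul, mul_assoc]
  exact hasSum_sum fun k _ => (hasSum_ite_le_sub k (h k)).mul_left _

theorem summable_norm_jacobiCoeff_div (P : Polynomial ℝ) {b : ℝ} (hb : -1 < b) :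
    Summable fun m => ‖jacobiCoeff P b m‖ / ((m : ℝ) + 1) := by
  have h : ∀ k, Summable fun m : ℕ =>
      ‖(if k ≤ m then (oneSubRpowCoeff b (m - k) : ℂ) else 0)‖ / ((m : ℝ) + 1) := by
    intro k
    refine (summable_nat_add_iff k).1 (Summable.of_nonneg_of_le (fun j => by positivity)
      (fun j => ?_) (summable_abs_oneSubRpowCoeff_div hb))
    rw [if_pos (Nat.le_add_left k j), Nat.add_sub_cancel, Complex.norm_real, Real.norm_eq_abs]
    gcongr
    simp
  refine Summable.of_nonneg_of_le (fun m => by positivity) (fun m => ?_)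
    (summable_sum (s := Finset.range (P.natDegree + 1)) fun k _ =>
      (h k).mul_left ‖(P.coeff k : ℂ)‖)
  simp only [mul_div_assoc', ← Finset.sum_div, ← norm_mul]
  gcongr
  exact norm_sum_le _ _

theorem hasSum_jacobiCoeff_mul_pow (P : Polynomial ℝ) (b : ℝ) {x : ℝ} (hx0 : 0 ≤ x) (hx1 : x < 1) :
    HasSum (fun m => jacobiCoeff P b m * (x : ℂ) ^ m) ((P.eval x * (1 - x) ^ b : ℝ) : ℂ) := by
  have h := hasSum_jacobiCoeff_mul P b (w := fun m => (x : ℂ) ^ m)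
    (A := fun k => (x : ℂ) ^ k * (((1 - x) ^ b : ℝ) : ℂ)) (fun k => by
      have := (Complex.hasSum_ofReal.2 (hasSum_oneSubRpowCoeff b hx0 hx1)).mul_left ((x : ℂ) ^ k)
      convert! this using 2 with j
      push_cast
      ring)
  convert h using 1
  rw [Polynomial.eval_eq_sum_range]
  push_cast
  rw [Finset.sum_mul]
  exact Finset.sum_congr rfl fun k _ => by ring

/-- Multiplication by `u^k` shifts the Mellin variable from `s` to `s + k`, which stays in the slit
plane. -/
theorem poleSeries_jacobiCoeff (P : Polynomial ℝ) {b : ℝ} (hb : -1 < b) {s : ℂ}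
    (hs : s ∈ Complex.slitPlane) :
    poleSeries (jacobiCoeff P b) s = Complex.Gamma (b + 1) *
      ∑ k ∈ Finset.range (P.natDegree + 1), (P.coeff k : ℂ) *
        (Complex.Gamma (s + k) * (Complex.Gamma (s + k + (b + 1)))⁻¹) := by
  have hc : Summable fun m => ‖(oneSubRpowCoeff b m : ℂ)‖ / ((m : ℝ) + 1) := by
    simpa only [Complex.norm_real, Real.norm_eq_abs] using summable_abs_oneSubRpowCoeff_div hb
  have h := hasSum_jacobiCoeff_mul P b (w := fun m => (s + m)⁻¹) (A := fun k =>
    Complex.Gamma (b + 1) * (Complex.Gamma (s + k) * (Complex.Gamma (s + k + (b + 1)))⁻¹))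
    (fun k => by
      have hk : s + k ∈ Complex.slitPlane := by
        rw [Complex.mem_slitPlane_iff] at hs ⊢
        simp only [Complex.add_re, Complex.natCast_re, Complex.add_im, Complex.natCast_im, add_zero]
        exact hs.imp_left fun h => by positivity
      obtain ⟨δ, hδ, hball⟩ := exists_ball_poleCompl (slitPlane_subset_poleCompl hk)
      have := (summable_div_add_natCast hc hδ (hball _ (Metric.mem_ball_self hδ))).hasSum
      rw [← poleSeries_oneSubRpowCoeff hb hk]
      convert! this using 2 with j
      push_cast
      rw [div_eq_mul_inv, add_assoc, add_comm (k : ℂ)])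
  rw [poleSeries]
  simp only [div_eq_mul_inv]
  rw [h.tsum_eq, Finset.mul_sum]
  exact Finset.sum_congr rfl fun k _ => by ring

end

section

open Filter Topology Polynomial

/-! ### The polynomial factor of the Mellin transform -/

theorem Complex.Gamma_mul_ascPochhammer_eval {s : ℂ} (hs : s ∈ poleCompl) (k : ℕ) :
    Complex.Gamma s * (ascPochhammer ℂ k).eval s = Complex.Gamma (s + k) := by
  induction k with
  | zero => simp
  | succ k ih =>
    rw [ascPochhammer_succ_eval, ← mul_assoc, ih, mul_comm, ← Complex.Gamma_add_one _ (hs k)]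
    push_cast
    rw [add_assoc]

/-- No condition on `z`: `1/Γ` is entire, and at the poles the convention `Γ = 0` gives its correct
value `0`. -/
theorem Complex.inv_Gamma_eq_ascPochhammer_eval_mul (z : ℂ) (k : ℕ) :
    (Complex.Gamma z)⁻¹ = (ascPochhammer ℂ k).eval z * (Complex.Gamma (z + k))⁻¹ := by
  induction k with
  | zero => simp
  | succ k ih =>
    rw [ih, Complex.one_div_Gamma_eq_self_mul_one_div_Gamma_add_one, ascPochhammer_succ_eval]
    push_cast
    rw [add_assoc, mul_assoc]

theorem ascPochhammer_eval_eq_prod (k : ℕ) (z : ℂ) :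
    (ascPochhammer ℂ k).eval z = ∏ l ∈ Finset.range k, (z + l) := by
  induction k with
  | zero => simp
  | succ k ih => rw [ascPochhammer_succ_eval, ih, Finset.prod_range_succ]

theorem ascPochhammer_eval_neg_add (k : ℕ) (z : ℂ) :
    (ascPochhammer ℂ k).eval (-(k + z)) = (-1) ^ k * (ascPochhammer ℂ k).eval (z + 1) := by
  rw [ascPochhammer_eval_eq_prod, ascPochhammer_eval_eq_prod, ← Finset.prod_range_reflect,
    ← Finset.card_range k, ← Finset.prod_const, Finset.card_range, ← Finset.prod_mul_distrib]
  refine Finset.prod_congr rfl fun l hl => ?_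
  have h : ((k - 1 - l : ℕ) : ℂ) + l + 1 = k := by
    have := Finset.mem_range.1 hl
    exact_mod_cast (by omega : k - 1 - l + l + 1 = k)
  linear_combination h

/-- The polynomial `G` for which `Γ(s) G(s) / Γ(s + deg P + b + 1)` is, up to the factor
`Γ(b + 1)`, the Mellin transform of `P(u) (1 - u) ^ b` on `(0, 1)`. -/
noncomputable def mellinPoly (P : ℝ[X]) (b : ℝ) : ℂ[X] :=
  ∑ k ∈ Finset.range (P.natDegree + 1), C (P.coeff k : ℂ) *
    (ascPochhammer ℂ k * (ascPochhammer ℂ (P.natDegree - k)).comp (X + C ((k : ℂ) + (b + 1))))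

theorem mellinPoly_eval (P : ℝ[X]) (b : ℝ) (s : ℂ) :
    (mellinPoly P b).eval s = ∑ k ∈ Finset.range (P.natDegree + 1), (P.coeff k : ℂ) *
      ((ascPochhammer ℂ k).eval s *
        (ascPochhammer ℂ (P.natDegree - k)).eval (s + k + (b + 1))) := by
  simp [mellinPoly, eval_finsetSum, add_assoc]

theorem natDegree_mellinPoly_le (P : ℝ[X]) (b : ℝ) :
    (mellinPoly P b).natDegree ≤ P.natDegree := by
  refine natDegree_sum_le_of_forall_le _ _ fun k hk => ?_
  refine (natDegree_C_mul_le _ _).trans (natDegree_mul_le.trans ?_)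
  rw [natDegree_comp, natDegree_X_add_C, ascPochhammer_natDegree, ascPochhammer_natDegree]
  have := Finset.mem_range.1 hk
  omega

theorem sum_coeff_mul_Gamma (P : ℝ[X]) (b : ℝ) {s : ℂ} (hs : s ∈ poleCompl) :
    ∑ k ∈ Finset.range (P.natDegree + 1), (P.coeff k : ℂ) *
        (Complex.Gamma (s + k) * (Complex.Gamma (s + k + (b + 1)))⁻¹) =
      Complex.Gamma s * (Complex.Gamma (s + P.natDegree + b + 1))⁻¹ * (mellinPoly P b).eval s := by
  rw [mellinPoly_eval, Finset.mul_sum]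
  refine Finset.sum_congr rfl fun k hk => ?_
  have hk' : ((P.natDegree - k : ℕ) : ℂ) + k = P.natDegree := by
    have := Finset.mem_range.1 hk
    exact_mod_cast (by omega : P.natDegree - k + k = P.natDegree)
  rw [← Complex.Gamma_mul_ascPochhammer_eval hs k,
    Complex.inv_Gamma_eq_ascPochhammer_eval_mul (s + k + (b + 1)) (P.natDegree - k),
    show s + k + (b + 1) + ((P.natDegree - k : ℕ) : ℂ) = s + P.natDegree + b + 1 by
      rw [← hk']; ring]
  ring

/-- For `k < deg P` the second Pochhammer factor starts at `-(deg P - k - 1)` and has `deg P - k`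
factors, so it contains zero; only the leading term remains. -/
theorem mellinPoly_eval_neg {P : ℝ[X]} (hP : P.Monic) (b : ℝ) :
    (mellinPoly P b).eval (-((P.natDegree : ℂ) + b)) =
      (-1) ^ P.natDegree * (ascPochhammer ℂ P.natDegree).eval ((b : ℂ) + 1) := by
  rw [mellinPoly_eval, Finset.sum_range_succ, Finset.sum_eq_zero, zero_add, hP.coeff_natDegree,
    Nat.sub_self, ascPochhammer_zero, eval_one, mul_one, Complex.ofReal_one, one_mul,
    ascPochhammer_eval_neg_add]
  intro k hk
  have hk' := Finset.mem_range.1 hk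
  have h : ((P.natDegree - k - 1 : ℕ) : ℂ) + k + 1 = P.natDegree := by
    exact_mod_cast (by omega : P.natDegree - k - 1 + k + 1 = P.natDegree)
  rw [show -((P.natDegree : ℂ) + b) + k + (b + 1) = -((P.natDegree - k - 1 : ℕ) : ℂ) by
      linear_combination h,
    ascPochhammer_eval_neg_coe_nat_of_lt (by omega), mul_zero, mul_zero]

/-- The `j`-th moment is the Gamma sum of `poleSeries_jacobiCoeff` at `s = a + 1 + j`, so
orthogonality becomes vanishing at these points. -/
theorem integral_pow_mul_eval_mul_jacobiWeight (P : ℝ[X]) {a b : ℝ} (ha : -1 < a) (hb : -1 < b)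
    (j : ℕ) :
    ((∫ x in (0 : ℝ)..1, x ^ j * P.eval x * jacobiWeight a b x : ℝ) : ℂ) =
      Complex.Gamma (b + 1) * ∑ k ∈ Finset.range (P.natDegree + 1), (P.coeff k : ℂ) *
        (Complex.Gamma ((a : ℂ) + 1 + j + k) *
          (Complex.Gamma ((a : ℂ) + 1 + j + k + (b + 1)))⁻¹) := by
  have hre : ∀ k : ℕ, 0 < ((a : ℂ) + 1 + j + k).re := fun k => by
    simp only [Complex.add_re, Complex.ofReal_re, Complex.one_re, Complex.natCast_re]
    have : 0 < a + 1 := by linarith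
    positivity
  have hre' : 0 < ((b : ℂ) + 1).re := by simp; linarith
  have hsum : ∫ x in (0 : ℝ)..1, ((x ^ j * P.eval x * jacobiWeight a b x : ℝ) : ℂ) =
      ∫ x in (0 : ℝ)..1, ∑ k ∈ Finset.range (P.natDegree + 1), (P.coeff k : ℂ) *
        ((x : ℂ) ^ ((a : ℂ) + 1 + j + k - 1) * (1 - (x : ℂ)) ^ ((b : ℂ) + 1 - 1)) := by
    refine intervalIntegral.integral_congr_ae (Eventually.of_forall fun x hx => ?_)
    rw [Set.uIoc_of_le zero_le_one] at hx
    have hx0 : (x : ℂ) ≠ 0 := by exact_mod_cast hx.1.ne'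
    rw [jacobiWeight, P.eval_eq_sum_range, add_sub_cancel_right]
    push_cast
    rw [Complex.ofReal_cpow hx.1.le, Complex.ofReal_cpow (by linarith [hx.2]), Finset.mul_sum,
      Finset.sum_mul]
    refine Finset.sum_congr rfl fun k _ => ?_
    rw [show (a : ℂ) + 1 + j + k - 1 = a + j + k by ring, Complex.cpow_add _ _ hx0,
      Complex.cpow_add _ _ hx0, Complex.cpow_natCast, Complex.cpow_natCast]
    push_cast
    ring
  rw [← intervalIntegral.integral_ofReal, hsum, intervalIntegral.integral_finsetSum
    fun k _ => (Complex.betaIntegral_convergent (hre k) hre').const_mul _, Finset.mul_sum]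
  refine Finset.sum_congr rfl fun k _ => ?_
  have h := Complex.betaIntegral_eq_Gamma_mul_div _ _ (hre k) hre'
  rw [Complex.betaIntegral] at h
  rw [intervalIntegral.integral_const_mul, h]
  ring

/-! ### Orthogonality as interpolation -/

theorem IsJacobiPineiroII.mellinPoly_eval_eq_zero {p : ℕ} {n : Fin p → ℕ} {α : Fin p → ℝ} {β : ℝ}
    {P : ℝ[X]} (hP : IsJacobiPineiroII n α β P) (hα : ∀ i, -1 < α i) (hβ : -1 < β) (i : Fin p)
    (j : ℕ) (hj : j < n i) : (mellinPoly P β).eval ((α i : ℂ) + 1 + j) = 0 := by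
  have hre : ∀ t : ℝ, 0 ≤ t → 0 < ((α i : ℂ) + 1 + j + t).re := fun t ht => by
    simp only [Complex.add_re, Complex.ofReal_re, Complex.one_re, Complex.natCast_re]
    have : 0 < α i + 1 := by linarith [hα i]
    positivity
  have hre0 : 0 < ((α i : ℂ) + 1 + j).re := by simpa using hre 0 le_rfl
  have hmem : (α i : ℂ) + 1 + j ∈ poleCompl :=
    slitPlane_subset_poleCompl (Complex.mem_slitPlane_iff.2 (Or.inl hre0))
  have h := integral_pow_mul_eval_mul_jacobiWeight P (hα i) hβ j
  have hne : Complex.Gamma ((α i : ℂ) + 1 + j + P.natDegree + β + 1) ≠ 0 := by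
    refine Complex.Gamma_ne_zero_of_re_pos ?_
    have := hre (P.natDegree + (β + 1)) (by have : 0 < β + 1 := by linarith
                                            positivity)
    push_cast at this
    rwa [← add_assoc, ← add_assoc] at this
  rw [hP.orthogonal i j hj, Complex.ofReal_zero, sum_coeff_mul_Gamma P β hmem] at h
  have hne1 : Complex.Gamma ((β : ℂ) + 1) ≠ 0 :=
    Complex.Gamma_ne_zero_of_re_pos (by simp; linarith)
  have hne2 := Complex.Gamma_ne_zero_of_re_pos hre0
  simpa [hne, hne1, hne2] using h.symm

/-- The polynomial `∏ i, (α i + 1 - s)_{n i}` in `s`. -/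
noncomputable def nodePoly {p : ℕ} (n : Fin p → ℕ) (α : Fin p → ℝ) : ℂ[X] :=
  ∏ i, (ascPochhammer ℂ (n i)).comp (C ((α i : ℂ) + 1) - X)

theorem nodePoly_eval {p : ℕ} (n : Fin p → ℕ) (α : Fin p → ℝ) (s : ℂ) :
    (nodePoly n α).eval s = ∏ i, rising ((α i : ℂ) + 1 - s) (n i) := by
  simp [nodePoly, rising, eval_prod]

theorem natDegree_nodePoly_le {p : ℕ} (n : Fin p → ℕ) (α : Fin p → ℝ) :
    (nodePoly n α).natDegree ≤ ∑ i, n i := by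
  refine (natDegree_prod_le _ _).trans (Finset.sum_le_sum fun i _ => ?_)
  refine natDegree_comp_le.trans ?_
  rw [ascPochhammer_natDegree]
  refine (Nat.mul_le_mul_left _ (natDegree_sub_le _ _)).trans ?_
  simp

theorem nodePoly_eval_node {p : ℕ} (n : Fin p → ℕ) (α : Fin p → ℝ) (i : Fin p) (j : ℕ)
    (hj : j < n i) : (nodePoly n α).eval ((α i : ℂ) + 1 + j) = 0 := by
  rw [nodePoly_eval]
  refine Finset.prod_eq_zero (Finset.mem_univ i) ?_
  rw [rising, sub_add_cancel_left, ascPochhammer_eval_neg_coe_nat_of_lt hj]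

theorem prod_rising_ne_zero {p : ℕ} (n : Fin p → ℕ) {α : Fin p → ℝ} {β : ℝ} (hα : ∀ i, -1 < α i)
    (hβ : -1 < β) :
    ∏ i, rising ((α i : ℂ) + (β : ℂ) + ((∑ k, n k : ℕ) : ℂ) + 1) (n i) ≠ 0 := by
  refine Finset.prod_ne_zero_iff.2 fun i _ => ?_
  rw [rising, ascPochhammer_eval_eq_prod]
  refine Finset.prod_ne_zero_iff.2 fun l hl => ?_
  -- A factor exists only if `n i ≥ 1`; then `|n| + 1 ≥ 2` outweighs `α i + β > -2`.
  have h1 : 1 ≤ ∑ k, n k := (Nat.one_le_iff_ne_zero.2 (Finset.mem_range.1 hl).ne_bot).trans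
    (Finset.single_le_sum (f := n) (fun _ _ => Nat.zero_le _) (Finset.mem_univ i))
  have h2 : (1 : ℝ) ≤ ((∑ k, n k : ℕ) : ℝ) := by exact_mod_cast h1
  have h3 : 0 < α i + β + ((∑ k, n k : ℕ) : ℝ) + 1 + l := by
    have := Nat.cast_nonneg (α := ℝ) l
    linarith [hα i]
  exact_mod_cast h3.ne'

/-- Orthogonality determines the Mellin transform of the Jacobi-Piñeiro polynomial. -/
theorem IsJacobiPineiroII.mellinPoly_eval_mul {p : ℕ} {n : Fin p → ℕ} {α : Fin p → ℝ} {β : ℝ}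
    {P : ℝ[X]} (hP : IsJacobiPineiroII n α β P) (hα : ∀ i, -1 < α i) (hβ : -1 < β)
    (hαα : ∀ i j, i ≠ j → ∀ m : ℤ, α i - α j ≠ (m : ℝ)) (s : ℂ) :
    (mellinPoly P β).eval s *
        ∏ i, rising ((α i : ℂ) + (β : ℂ) + ((∑ k, n k : ℕ) : ℂ) + 1) (n i) =
      (∏ i, rising ((α i : ℂ) + 1 - s) (n i)) *
        ((-1) ^ (∑ i, n i) * (ascPochhammer ℂ (∑ i, n i)).eval ((β : ℂ) + 1)) := by
  set N := ∑ i, n i with hN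
  set s₀ : ℂ := -((N : ℂ) + β) with hs₀
  have hG := mellinPoly_eval_neg hP.monic β
  rw [hP.natDegree_eq, ← hs₀] at hG
  have hQ : (nodePoly n α).eval s₀ = ∏ i, rising ((α i : ℂ) + β + N + 1) (n i) := by
    rw [nodePoly_eval]
    refine Finset.prod_congr rfl fun i _ => ?_
    congr 1
    rw [hs₀]
    ring
  have hQne : (nodePoly n α).eval s₀ ≠ 0 := hQ ▸ prod_rising_ne_zero n hα hβ
  rw [← hQ, ← hG, ← nodePoly_eval]
  -- `D` has degree at most `N` and vanishes at the `N` orthogonality nodes and, by construction, at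
  -- `s₀`.
  set D : ℂ[X] := mellinPoly P β * C ((nodePoly n α).eval s₀) -
    nodePoly n α * C ((mellinPoly P β).eval s₀) with hD
  set node : Option (Σ i, Fin (n i)) → ℂ :=
    fun o => o.elim s₀ fun q => (α q.1 : ℂ) + 1 + (q.2 : ℕ) with hnode
  have hsome : ∀ q : Σ i, Fin (n i), (nodePoly n α).eval (node (some q)) = 0 := fun q =>
    nodePoly_eval_node n α q.1 q.2 q.2.2
  have hinj : Function.Injective node := by
    rintro (_ | ⟨i, j⟩) (_ | ⟨i', j'⟩) h
    · rfl
    · exact absurd ((congrArg (fun w => (nodePoly n α).eval w) h).trans (hsome ⟨i', j'⟩)) hQne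
    · exact absurd ((congrArg (fun w => (nodePoly n α).eval w) h.symm).trans (hsome ⟨i, j⟩)) hQne
    · have h1 : α i + 1 + (j : ℕ) = α i' + 1 + (j' : ℕ) := by
        simp only [hnode, Option.elim] at h
        exact_mod_cast h
      obtain rfl : i = i' := by
        by_contra hne
        refine hαα i i' hne ((j' : ℕ) - (j : ℕ) : ℤ) ?_
        push_cast
        linarith
      have h2 : (j : ℕ) = j' := by exact_mod_cast add_left_cancel h1
      rw [Fin.ext h2]
  have hDzero : D = 0 := by
    refine eq_zero_of_natDegree_lt_card_of_eval_eq_zero D hinj ?_ ?_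
    · rintro (_ | q)
      · simp only [hD, hnode, Option.elim, eval_sub, eval_mul, eval_C]
        ring
      · have h1 : (mellinPoly P β).eval (node (some q)) = 0 :=
          hP.mellinPoly_eval_eq_zero hα hβ q.1 q.2 q.2.2
        rw [hD, eval_sub, eval_mul, eval_mul, h1, hsome]
        simp
    · rw [Fintype.card_option, Fintype.card_sigma, Nat.lt_succ_iff]
      simp only [Fintype.card_fin]
      refine (natDegree_sub_le _ _).trans (max_le ?_ ?_)
      · refine (natDegree_mul_C_le _ _).trans ((natDegree_mellinPoly_le P β).trans ?_)
        rw [hP.natDegree_eq]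
      · exact (natDegree_mul_C_le _ _).trans (natDegree_nodePoly_le n α)
  have h := congrArg (eval s) hDzero
  simp only [hD, eval_sub, eval_mul, eval_C, eval_zero] at h
  exact sub_eq_zero.1 h

theorem IsJacobiPineiroII.poleSeries_jacobiCoeff {p : ℕ} {n : Fin p → ℕ} {α : Fin p → ℝ} {β : ℝ}
    {P : ℝ[X]} (hP : IsJacobiPineiroII n α β P) (hα : ∀ i, -1 < α i) (hβ : -1 < β)
    (hαα : ∀ i j, i ≠ j → ∀ m : ℤ, α i - α j ≠ (m : ℝ)) {s : ℂ} (hs : s ∈ Complex.slitPlane) :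
    poleSeries (jacobiCoeff P β) s =
      (-1) ^ (∑ i, n i) * Complex.Gamma (((∑ i, n i : ℕ) : ℂ) + (β : ℂ) + 1) /
          (∏ i, rising ((α i : ℂ) + (β : ℂ) + ((∑ k, n k : ℕ) : ℂ) + 1) (n i)) *
        (Complex.Gamma s / Complex.Gamma (s + ((∑ i, n i : ℕ) : ℂ) + (β : ℂ) + 1) *
          (∏ i, rising ((α i : ℂ) + 1 - s) (n i))) := by
  have hb : (β : ℂ) + 1 ∈ poleCompl := slitPlane_subset_poleCompl
    (Complex.mem_slitPlane_iff.2 (Or.inl (by simp; linarith)))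
  have h1 := Complex.Gamma_mul_ascPochhammer_eval hb (∑ i, n i)
  have h2 := hP.mellinPoly_eval_mul hα hβ hαα s
  have hne := prod_rising_ne_zero n hα hβ
  rw [_root_.poleSeries_jacobiCoeff P hβ hs,
    sum_coeff_mul_Gamma P β (slitPlane_subset_poleCompl hs), hP.natDegree_eq,
    show (((∑ i, n i : ℕ) : ℂ) + (β : ℂ) + 1) = (β : ℂ) + 1 + ((∑ i, n i : ℕ) : ℂ) by ring, ← h1]
  rw [← eq_div_iff hne] at h2
  rw [h2]
  ring

/-! ### The integral representation -/

theorem IsLoopContour.hasContourIntegral_const_mul_iff {γ : ℝ → ℂ} (hγ : IsLoopContour γ)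
    {f g : ℂ → ℂ} {a : ℂ} (ha : a ≠ 0) (h : ∀ s ∈ Complex.slitPlane, f s = a * g s) {I : ℂ} :
    HasContourIntegral f γ (a * I) ↔ HasContourIntegral g γ I := by
  have : (fun T : ℝ × ℝ => ∫ t in T.1..T.2, f (γ t) * deriv γ t) =
      fun T => a * ∫ t in T.1..T.2, g (γ t) * deriv γ t := by
    ext T
    rw [← intervalIntegral.integral_const_mul]
    congr 1
    ext t
    rw [h _ (hγ.mem_slitPlane t), mul_assoc]
  rw [HasContourIntegral, HasContourIntegral, this]
  exact tendsto_const_smul_iff₀ ha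

end

theorem theorem3p10 {p : ℕ} (n : Fin p → ℕ) (α : Fin p → ℝ) (β : ℝ)
    (hα : ∀ i, -1 < α i) (hβ : -1 < β)
    (hαα : ∀ i j, i ≠ j → ∀ m : ℤ, α i - α j ≠ (m : ℝ))
    (P : Polynomial ℝ) (hP : IsJacobiPineiroII n α β P)
    (x : ℝ) (hx0 : 0 < x) (hx1 : x < 1)
    (γ : ℝ → ℂ) (hγ : IsLoopContour γ) :
    ((∃ δ : ℝ, 0 < δ ∧ ∀ t, δ ≤ Metric.infDist (γ t) nonposAxis) →
      ∃ I : ℂ, HasContourIntegral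
        (fun s : ℂ => Complex.Gamma s / Complex.Gamma (s + ((∑ i, n i : ℕ) : ℂ) + (β : ℂ) + 1) *
          (∏ i, rising ((α i : ℂ) + 1 - s) (n i)) * (x : ℂ) ^ (-s) /
            (2 * (Real.pi : ℂ) * Complex.I)) γ I) ∧
    (∀ I : ℂ, HasContourIntegral
        (fun s : ℂ => Complex.Gamma s / Complex.Gamma (s + ((∑ i, n i : ℕ) : ℂ) + (β : ℂ) + 1) *
          (∏ i, rising ((α i : ℂ) + 1 - s) (n i)) * (x : ℂ) ^ (-s) /
            (2 * (Real.pi : ℂ) * Complex.I)) γ I →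
      ((P.eval x * (1 - x) ^ β : ℝ) : ℂ) =
        (-1) ^ (∑ i, n i) * Complex.Gamma (((∑ i, n i : ℕ) : ℂ) + (β : ℂ) + 1) /
          (∏ i, rising ((α i : ℂ) + (β : ℂ) + ((∑ k, n k : ℕ) : ℂ) + 1) (n i)) * I) := by

  have hx : ∀ s : ℂ, s ∈ Complex.slitPlane → _ := fun s hs => hP.poleSeries_jacobiCoeff hα hβ hαα hs
  set N := ∑ i, n i with hN
  set κ : ℂ := (-1) ^ N * Complex.Gamma ((N : ℂ) + (β : ℂ) + 1) /
    (∏ i, rising ((α i : ℂ) + (β : ℂ) + (N : ℂ) + 1) (n i)) with hκ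
  have hΓ : Complex.Gamma ((N : ℂ) + (β : ℂ) + 1) ≠ 0 :=
    Complex.Gamma_ne_zero_of_re_pos (by
      simp only [Complex.add_re, Complex.natCast_re, Complex.ofReal_re, Complex.one_re]
      linarith [Nat.cast_nonneg (α := ℝ) N])
  have hκ0 : κ ≠ 0 := div_ne_zero (mul_ne_zero (pow_ne_zero _ (by norm_num)) hΓ)
    (prod_rising_ne_zero n hα hβ)
  have hπ : 2 * (Real.pi : ℂ) * Complex.I ≠ 0 := Complex.two_pi_I_ne_zero
  -- On the slit plane the integrand is the kernel divided by `κ · 2πi`, so both claims transfer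
  -- from the residue theorem for `poleKernel`.
  have hker := fun I : ℂ => hγ.hasContourIntegral_const_mul_iff
    (f := fun s : ℂ => Complex.Gamma s / Complex.Gamma (s + (N : ℂ) + (β : ℂ) + 1) *
      (∏ i, rising ((α i : ℂ) + 1 - s) (n i)) * (x : ℂ) ^ (-s) / (2 * (Real.pi : ℂ) * Complex.I))
    (g := poleKernel (jacobiCoeff P β) x) (a := (κ * (2 * (Real.pi : ℂ) * Complex.I))⁻¹)
    (inv_ne_zero (mul_ne_zero hκ0 hπ)) (fun s hs => by
      rw [poleKernel, hx s hs]
      field_simp) (I := I)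
  have hc := summable_norm_jacobiCoeff_div P hβ
  have hS := hasSum_jacobiCoeff_mul_pow P β hx0.le hx1
  refine ⟨fun ⟨δ, hδ, hdist⟩ => ⟨_, (hker _).2
    (hγ.hasContourIntegral_poleKernel hc hx0 hx1 hS hδ hdist)⟩, fun I hI => ?_⟩
  have h := hγ.eq_of_hasContourIntegral_poleKernel hc hx0 hx1 hS
    (I := κ * (2 * (Real.pi : ℂ) * Complex.I) * I) ((hker _).1 (by
      rwa [inv_mul_cancel_left₀ (mul_ne_zero hκ0 hπ)]))
  refine mul_left_cancel₀ hπ ?_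
  rw [← h]
  ring
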